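/- Let $\mathcal X=[0,1]$ and let $\mathbb C=\{h_z : z\in(0,1)\}$ be the class of threshold classifiers, where $h_z(x)=+1$ if $x\ge z$ and $h_z(x)=-1$ otherwise. For a joint distribution $P$ on $\mathcal X\times\{-1,+1\}$ and a classifier (measurable function) $h:\mathcal X\to\{-1,+1\}$ let $\mathrm{er}_P(h)=P\{(x,y):h(x)\ne y\}$, $\nu=\nu(P)=\inf_{h\in\mathbb C}\mathrm{er}_P(h)$ and $\eta(x)=P(Y=+1\mid X=x)$. Let $(X_1,Y_1),(X_2,Y_2),\dots$ be i.i.d. with law $P$. A passive algorithm maps a finite labeled sample to a classifier. An active algorithm with budget $n$ sees the whole sequence $X_1,X_2,\dots$ and requests labels $Y_i$ sequentially, at most $n$ in total, before it returns a classifier. Both may be randomized. A label complexity is a function $\Lambda$ of $(\varepsilon,P)$ with values in $\{1,2,\dots\}\cup\{\infty\}$; an algorithm achieves $\Lambda$ if for every $P$, every $\varepsilon\in(0,1)$ and every integer $n\ge\Lambda(\varepsilon,P)$, the classifier $\hat h$ that it returns (from $n$ labeled examples if passive, with budget $n$ if active) has $\mathbb E[\mathrm{er}_P(\hat h)]\le\varepsilon$.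 All asymptotics are as $\varepsilon\downarrow0$. $\mathrm{Nontrivial}(\Lambda;\mathbb C)$ is the set of $P$ such that $\Lambda(\nu+\varepsilon,P)<\infty$ for all $\varepsilon>0$ and $g(\varepsilon)=o(\Lambda(\nu+\varepsilon,P))$ for every nonnegative $g$ with $g(\varepsilon)=O(\log^k(1/\varepsilon))$ for some $k\in[0,\infty)$. An active meta-algorithm $\mathcal A_a$ assigns to each passive algorithm $\mathcal A_p$ an active algorithm $\mathcal A_a(\mathcal A_p,\cdot)$; it is an activizer for $\mathcal A_p$ with respect to $\mathbb C$ in the agnostic case if for every label complexity $\Lambda_p$ achieved by $\mathcal A_p$, the algorithm $\mathcal A_a(\mathcal A_p,\cdot)$ achieves a label complexity $\Lambda_a$ such that for every $P\in\mathrm{Nontrivial}(\Lambda_p;\mathbb C)$ there is a constant $c\in[1,\infty)$ with $\Lambda_a(\nu+c\varepsilon,P)=o(\Lambda_p(\nu+\varepsilon,P))$. Let $\check{\mathcal A}_p$ be the passive algorithm that, given $(X_1,Y_1),\dots,(X_n,Y_n)$, returns $h_{\hat z}$ with $\hat z=\frac{1-2\hat\eta_0}{1-\hat\eta_0}$, where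 $$\hat\eta_0=\min\Big\{\max\Big\{\frac{|\{i\le n: X_i=0,\,Y_i=+1\}|}{|\{i\le n: X_i=0\}|},\frac18\Big\},\frac38\Big\},$$ and $\hat\eta_0=\frac18$ if no $X_i$ equals $0$. Let $\mathbb D$ be the family of joint distributions $P$ whose marginal on $[0,1]$ is $\frac12\delta_0+\frac12\lambda$ ($\lambda$ Lebesgue measure), with $\eta(0)\in(\frac18,\frac38)$, and such that $\eta(x)=\eta(0)+\frac x2(1-\eta(0))$ for $x\in(0,1]$ (for some version of $\eta$). **Theorem.** 1. There is no activizer for $\check{\mathcal A}_p$ with respect to the class $\mathbb C$ of threshold classifiers in the agnostic case. 2. $\check{\mathcal A}_p$ achieves a label complexity $\Lambda_p$ with $\Lambda_p(\nu+\varepsilon,P)=\Theta(1/\varepsilon)$ for every $P\in\mathbb D$; yet for every active learning algorithm and every label complexity $\Lambda_a$ that it achieves, there is $P\in\mathbb D$ with $\Lambda_a(\nu+\varepsilon,P)\neq o(1/\varepsilon)$. -/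

import Mathlib

open MeasureTheory Filter Topology Set
open scoped ENNReal NNReal unitInterval

universe w u v

/-! ## Classifiers, joint distributions and error rates -/

/-- The label space `{-1, +1}`: `true` is the label `+1` and `false` is the label `-1`. -/
abbrev Label : Type := Bool

/-- A classifier is a measurable function from the instance space to the labels. -/
def Classifier (X : Type w) [MeasurableSpace X] : Type w :=
  {h : X → Label // Measurable h}

/-- A joint distribution on `X × {-1, +1}`. -/
abbrev JointDist (X : Type w) [MeasurableSpace X] : Type w :=
  ProbabilityMeasure (X × Label)

/-- The error rate `er(h) = P((x, y) : h(x) ≠ y)`. -/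
noncomputable def errorRate {X : Type w} [MeasurableSpace X] (P : JointDist X)
    (h : Classifier X) : ℝ :=
  (P : Measure (X × Label)).real {q | h.1 q.1 ≠ q.2}

/-- The noise rate `ν(C; P) = inf_{h ∈ C} er(h)` of a concept space `C`. -/
noncomputable def noiseRate {X : Type w} [MeasurableSpace X] (C : Set (Classifier X))
    (P : JointDist X) : ℝ :=
  ⨅ h : C, errorRate P h.1

/-- `η` is (a version of) the conditional label distribution `x ↦ P(Y = +1 | X = x)`. -/
def IsCondLabelDist {X : Type w} [MeasurableSpace X] (P : JointDist X) (η : X → ℝ) : Prop :=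
  Measurable η ∧ (∀ x, η x ∈ Icc (0 : ℝ) 1) ∧
    ∀ A : Set X, MeasurableSet A →
      (P : Measure (X × Label)).real (A ×ˢ {true}) =
        ∫ x in A, η x ∂(P : Measure (X × Label)).fst

/-! ## Learning algorithms -/

/-- A (possibly randomized) passive learning algorithm: from its internal randomness, drawn from
`law`, and any finite sequence of labeled examples, it produces a classifier. -/
structure PassiveAlgorithm (X : Type w) [MeasurableSpace X] where
  Rand : Type u
  [measurableRand : MeasurableSpace Rand]
  law : Measure Rand
  [isProb : IsProbabilityMeasure law]
  output : (n : ℕ) → Rand → (Fin n → X × Label) → Classifier X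
  measurable_output : ∀ n,
    Measurable fun p : (Rand × (Fin n → X × Label)) × X => (output n p.1.1 p.1.2).1 p.2

attribute [instance] PassiveAlgorithm.measurableRand PassiveAlgorithm.isProb

/-- The expected error rate `E[er(A(Z_n))]`, for `Z_n` a sequence of `n` independent examples with
distribution `P`, independent of the internal randomness of the algorithm. -/
noncomputable def PassiveAlgorithm.expectedError {X : Type w} [MeasurableSpace X]
    (A : PassiveAlgorithm.{w, u} X) (P : JointDist X) (n : ℕ) : ℝ :=
  ∫ p : A.Rand × (Fin n → X × Label), errorRate P (A.output n p.1 p.2)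
    ∂(A.law.prod (Measure.pi fun _ : Fin n => (P : Measure (X × Label))))

/-- A (possibly randomized) active learning algorithm. With label budget `n`, internal randomness
`r`, the whole sequence `x` of unlabeled examples, and the list `L` of the labels received so far
(in the order of the requests), `next n r x L` is either `some i`, a request for the label of the
`i`-th example, or `none`, the decision to halt; `output n r x L` is the classifier returned when
the labels received in total are `L`. -/
structure ActiveAlgorithm (X : Type w) [MeasurableSpace X] where
  Rand : Type v
  [measurableRand : MeasurableSpace Rand]
  law : Measure Rand
  [isProb : IsProbabilityMeasure law]
  next : ℕ → Rand → (ℕ → X) → List Label → Option ℕ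
  output : ℕ → Rand → (ℕ → X) → List Label → Classifier X
  measurable_next : ∀ n L o, MeasurableSet {p : Rand × (ℕ → X) | next n p.1 p.2 L = o}
  measurable_output : ∀ n L,
    Measurable fun p : (Rand × (ℕ → X)) × X => (output n p.1.1 p.1.2 L).1 p.2

attribute [instance] ActiveAlgorithm.measurableRand ActiveAlgorithm.isProb

namespace ActiveAlgorithm

variable {X : Type w} [MeasurableSpace X]

/-- The labels received within the first `t` steps, when the unlabeled examples are `x` and the
labels, revealed only on request, are `y`. -/
def received (A : ActiveAlgorithm.{w, v} X) (n : ℕ) (r : A.Rand) (x : ℕ → X) (y : ℕ → Label) :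
    ℕ → List Label
  | 0 => []
  | t + 1 =>
    match A.next n r x (A.received n r x y t) with
    | none => A.received n r x y t
    | some i => A.received n r x y t ++ [y i]

/-- The classifier `A(n)` returned with budget `n` on the data sequence `z`: the algorithm is
stopped after at most `n` label requests. -/
def run (A : ActiveAlgorithm.{w, v} X) (n : ℕ) (r : A.Rand) (z : ℕ → X × Label) : Classifier X :=
  A.output n r (fun i => (z i).1)
    (A.received n r (fun i => (z i).1) (fun i => (z i).2) n)

/-- The expected error rate `E[er(A(n))]`, for a sequence of independent examples with
distribution `P`, independent of the internal randomness of the algorithm. -/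
noncomputable def expectedError (A : ActiveAlgorithm.{w, v} X) (P : JointDist X) (n : ℕ) : ℝ :=
  ∫ p : A.Rand × (ℕ → X × Label), errorRate P (A.run n p.1 p.2)
    ∂(A.law.prod (Measure.infinitePi fun _ : ℕ => (P : Measure (X × Label))))

end ActiveAlgorithm

/-- An active meta-algorithm turns every passive algorithm into an active learning algorithm. -/
abbrev ActiveMetaAlgorithm (X : Type w) [MeasurableSpace X] :=
  PassiveAlgorithm.{w, u} X → ActiveAlgorithm.{w, v} X

/-! ## Label complexities -/

/-- The values `Λ(ε, P)` of a candidate label complexity, in `ℕ ∪ {∞}`. -/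
abbrev LabelComplexity (X : Type w) [MeasurableSpace X] : Type w :=
  ℝ → JointDist X → ℕ∞

/-- The passive algorithm `A` achieves the (strictly positive) label complexity `Λ`. -/
def PassiveAlgorithm.Achieves {X : Type w} [MeasurableSpace X] (A : PassiveAlgorithm.{w, u} X)
    (Λ : LabelComplexity X) : Prop :=
  (∀ ε P, 0 < Λ ε P) ∧
    ∀ (P : JointDist X), ∀ ε ∈ Ioo (0 : ℝ) 1, ∀ n : ℕ, Λ ε P ≤ n → A.expectedError P n ≤ ε

/-- The active algorithm `A` achieves the (strictly positive) label complexity `Λ`. -/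
def ActiveAlgorithm.Achieves {X : Type w} [MeasurableSpace X] (A : ActiveAlgorithm.{w, v} X)
    (Λ : LabelComplexity X) : Prop :=
  (∀ ε P, 0 < Λ ε P) ∧
    ∀ (P : JointDist X), ∀ ε ∈ Ioo (0 : ℝ) 1, ∀ n : ℕ, Λ ε P ≤ n → A.expectedError P n ≤ ε

/-! ## Asymptotics as `ε ↓ 0`, for functions of `ε` with values in `[0, ∞]` -/

/-- `a(ε) = o(b(ε))`; below, `b` always has finite positive values near `0`. -/
def LittleO (a b : ℝ → ℝ≥0∞) : Prop :=
  Tendsto (fun ε => a ε / b ε) (𝓝[>] 0) (𝓝 0)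

/-- `a(ε) = O(b(ε))`. -/
def BigO (a b : ℝ → ℝ≥0∞) : Prop :=
  limsup (fun ε => a ε / b ε) (𝓝[>] 0) < ⊤

/-- `a(ε) = Θ(b(ε))`. -/
def BigTheta (a b : ℝ → ℝ≥0∞) : Prop :=
  BigO a b ∧ BigO b a

/-- The class `Polylog(1/ε)`. -/
def Polylog : Set (ℝ → ℝ≥0) :=
  {g | ∃ k : ℝ, 0 ≤ k ∧
    BigO (fun ε => (g ε : ℝ≥0∞)) (fun ε => ENNReal.ofReal (Real.log (1 / ε) ^ k))}

/-- The set `Nontrivial(Λ; C)` of joint distributions. -/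
def NontrivialDists {X : Type w} [MeasurableSpace X] (Λ : LabelComplexity X)
    (C : Set (Classifier X)) : Set (JointDist X) :=
  {P | (∀ ε : ℝ, 0 < ε → Λ (noiseRate C P + ε) P < ⊤) ∧
    ∀ g ∈ Polylog,
      LittleO (fun ε => (g ε : ℝ≥0∞)) (fun ε => (Λ (noiseRate C P + ε) P : ℝ≥0∞))}

/-- The active meta-algorithm `Aa` activizes the passive algorithm `Ap` for the concept space `C`
in the agnostic case. -/
def Activizes {X : Type w} [MeasurableSpace X] (Aa : ActiveMetaAlgorithm.{w, u, v} X)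
    (Ap : PassiveAlgorithm.{w, u} X) (C : Set (Classifier X)) : Prop :=
  ∀ Λp : LabelComplexity X, Ap.Achieves Λp →
    ∃ Λa : LabelComplexity X, (Aa Ap).Achieves Λa ∧
      ∀ P ∈ NontrivialDists Λp C, ∃ c : ℝ, 1 ≤ c ∧
        LittleO (fun ε => (Λa (noiseRate C P + c * ε) P : ℝ≥0∞))
          (fun ε => (Λp (noiseRate C P + ε) P : ℝ≥0∞))

/-! ## Threshold classifiers on `[0, 1]` and the passive algorithm -/

/-- The threshold classifier `h_z`, equal to `+1` exactly on `[z, 1]`. -/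
noncomputable def thresholdClassifier (z : ℝ) : Classifier I :=
  ⟨fun x => decide (z ≤ (x : ℝ)), by
    refine measurable_to_bool ?_
    have : (fun x : I => decide (z ≤ (x : ℝ))) ⁻¹' {true} = {x : I | z ≤ (x : ℝ)} := by
      ext x; simp
    rw [this]
    exact measurableSet_le measurable_const measurable_subtype_coe⟩

/-- The class of threshold classifiers `h_z` with `z ∈ (0, 1)`. -/
def thresholdClass : Set (Classifier I) :=
  {h | ∃ z ∈ Ioo (0 : ℝ) 1, h = thresholdClassifier z}

/-- The number of examples at the point `0`. -/
noncomputable def countZero {n : ℕ} (S : Fin n → I × Label) : ℕ :=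
  (Finset.univ.filter fun i => (S i).1 = 0).card

/-- The number of examples at the point `0` with the label `+1`. -/
noncomputable def countZeroPos {n : ℕ} (S : Fin n → I × Label) : ℕ :=
  (Finset.univ.filter fun i => (S i).1 = 0 ∧ (S i).2 = true).card

/-- The estimate of `η(0)`: the empirical frequency of `+1` at the point `0`, clipped to
`[1/8, 3/8]`, and `1/8` if there is no example at `0`. -/
noncomputable def etaHat {n : ℕ} (S : Fin n → I × Label) : ℝ :=
  if countZero S = 0 then 1 / 8
  else (((countZeroPos S : ℝ) / (countZero S : ℝ)) ⊔ (1 / 8)) ⊓ (3 / 8)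

/-- The threshold determined by the estimate of `η(0)`. -/
noncomputable def zHat {n : ℕ} (S : Fin n → I × Label) : ℝ :=
  (1 - 2 * etaHat S) / (1 - etaHat S)

theorem measurable_countZero (n : ℕ) :
    Measurable (countZero : (Fin n → I × Label) → ℕ) := by
  have : (countZero : (Fin n → I × Label) → ℕ) =
      fun S => ∑ i : Fin n, if (S i).1 = 0 then 1 else 0 := by
    funext S; simp [countZero]
  rw [this]
  refine Finset.measurable_sum _ fun i _ => Measurable.ite ?_ measurable_const measurable_const
  exact (measurable_fst.comp (measurable_pi_apply i)) (measurableSet_singleton (0 : I))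

theorem measurable_countZeroPos (n : ℕ) :
    Measurable (countZeroPos : (Fin n → I × Label) → ℕ) := by
  have : (countZeroPos : (Fin n → I × Label) → ℕ) =
      fun S => ∑ i : Fin n, if (S i).1 = 0 ∧ (S i).2 = true then 1 else 0 := by
    funext S; simp [countZeroPos]
  rw [this]
  refine Finset.measurable_sum _ fun i _ => Measurable.ite ?_ measurable_const measurable_const
  exact ((measurable_fst.comp (measurable_pi_apply i)) (measurableSet_singleton (0 : I))).inter
    ((measurable_snd.comp (measurable_pi_apply i)) (measurableSet_singleton true))

theorem measurable_zHat (n : ℕ) : Measurable (zHat : (Fin n → I × Label) → ℝ) := by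
  have h0 : Measurable fun S : Fin n → I × Label => (countZero S : ℝ) :=
    (measurable_from_top (f := fun k : ℕ => (k : ℝ))).comp (measurable_countZero n)
  have h1 : Measurable fun S : Fin n → I × Label => (countZeroPos S : ℝ) :=
    (measurable_from_top (f := fun k : ℕ => (k : ℝ))).comp (measurable_countZeroPos n)
  have he : Measurable (etaHat : (Fin n → I × Label) → ℝ) := by
    refine Measurable.ite ?_ measurable_const
      (((h1.div h0).sup measurable_const).inf measurable_const)
    exact measurable_countZero n (measurableSet_singleton 0)
  exact (measurable_const.sub (measurable_const.mul he)).div (measurable_const.sub he)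

/-- The (deterministic) passive algorithm that estimates `η(0)` and returns the threshold
classifier determined by the estimate. -/
noncomputable def checkAlgorithm : PassiveAlgorithm.{0, u} I where
  Rand := PUnit.{u + 1}
  law := Measure.dirac PUnit.unit
  output := fun _ _ S => thresholdClassifier (zHat S)
  measurable_output := by
    intro n
    refine measurable_to_bool ?_
    have : (fun p : (PUnit.{u + 1} × (Fin n → I × Label)) × I =>
        (thresholdClassifier (zHat p.1.2)).1 p.2) ⁻¹' {true} =
        {p | zHat p.1.2 ≤ (p.2 : ℝ)} := by
      ext p; simp [thresholdClassifier]
    rw [this]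
    exact measurableSet_le
      ((measurable_zHat n).comp (measurable_snd.comp measurable_fst))
      (measurable_subtype_coe.comp measurable_snd)

/-! ## The family of distributions -/

/-- The marginal distribution: an atom of mass `1/2` at `0`, and half of the Lebesgue measure. -/
noncomputable def halfAtomMarginal : Measure I :=
  (2⁻¹ : ℝ≥0∞) • Measure.dirac (0 : I) + (2⁻¹ : ℝ≥0∞) • (volume : Measure I)

/-- The joint distributions with marginal `halfAtomMarginal` on `[0, 1]`, with
`η(0) ∈ (1/8, 3/8)`, and with `η(x) = η(0) + (x/2) (1 - η(0))` for `x ∈ (0, 1]`. -/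
def hardFamily : Set (JointDist I) :=
  {P | (P : Measure (I × Label)).fst = halfAtomMarginal ∧
    ∃ η : I → ℝ, IsCondLabelDist P η ∧ η 0 ∈ Ioo (1 / 8 : ℝ) (3 / 8) ∧
      ∀ x : I, 0 < x → η x = η 0 + ((x : ℝ) / 2) * (1 - η 0)}

/-! On the family `hardFamily` the optimal threshold is a smooth function of the single number θ =
η(0), and the margin |2η - 1| vanishes linearly at that threshold. An error of order d in θ
therefore costs excess error of order d². The passive algorithm sees about n/2 labels at the atom 0,
estimates θ with mean squared error O(1/n), and so has excess error O(1/n)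
(`IsHard.expectedError_checkAlgorithm_le`).

Choosing which labels to request does not help. Every label, wherever its instance lies, is a coin
whose bias depends smoothly on θ and stays away from 0 and 1, so one request carries only O(d²)
information for separating θ from θ + d. About 1/d² requests are needed (`two_point_bound`,
`biasClose_hardBias`), while no classifier, threshold or not, has excess error much below d² for
both parameters (`IsHard.sq_le_excess_add_excess`). Together these give
`ActiveAlgorithm.excess_add_excess_lower_bound`.

The claim concerns asymptotics at a fixed P, whereas the two-point bound needs a pair of parameters
adapted to n. If the active complexity were o(1/ε) at every member, each θ would have a rank N
beyond which its excess error is at most δ/n. There are uncountably many θ and countably many N, so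
some N serves infinitely many θ, hence two that are arbitrarily close. At n of order 1/d² the
two-point bound is violated (`ActiveAlgorithm.exists_not_littleO`). Since 1/ε dominates every
polylogarithm and the constant c can be absorbed by rescaling ε, an activizer would produce exactly
such an active algorithm. -/

/-! ## Independent labels with given biases -/

/-- The law of a label that is `+1` with probability `p`. -/
noncomputable def labelLaw (p : I) : Measure Label :=
  (volume : Measure I).map fun u => decide (u ≤ p)

theorem measurable_decide_le {α : Type*} [MeasurableSpace α] {f g : α → I} (hf : Measurable f)
    (hg : Measurable g) : Measurable fun a => decide (f a ≤ g a) := by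
  refine measurable_to_bool ?_
  have : (fun a => decide (f a ≤ g a)) ⁻¹' {true} = {a | f a ≤ g a} := by
    ext a; simp
  rw [this]
  exact measurableSet_le hf hg

instance (p : I) : IsProbabilityMeasure (labelLaw p) :=
  Measure.isProbabilityMeasure_map
    (measurable_decide_le measurable_id measurable_const).aemeasurable

theorem labelLaw_true (p : I) : labelLaw p {true} = ENNReal.ofReal p := by
  rw [labelLaw, Measure.map_apply (measurable_decide_le measurable_id' measurable_const)
    (measurableSet_singleton _)]
  have : (fun u : I => decide (u ≤ p)) ⁻¹' {true} = Iic p := by ext; simp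
  rw [this, unitInterval.volume_Iic]

theorem labelLaw_false (p : I) : labelLaw p {false} = ENNReal.ofReal (1 - p) := by
  rw [labelLaw, Measure.map_apply (measurable_decide_le measurable_id' measurable_const)
    (measurableSet_singleton _)]
  have : (fun u : I => decide (u ≤ p)) ⁻¹' {false} = Ioi p := by ext; simp
  rw [this, unitInterval.volume_Ioi]

theorem labelLaw_eq (p : I) : labelLaw p =
    ENNReal.ofReal p • labelLaw 1 + ENNReal.ofReal (1 - p) • labelLaw 0 := by
  refine Measure.ext_of_singleton fun b => ?_
  cases b <;> simp [labelLaw_true, labelLaw_false]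

/-- The law of a sequence of independent labels, the `i`-th being `+1` with probability `p i`. -/
noncomputable def labelSeqLaw (p : ℕ → I) : Measure (ℕ → Label) :=
  Measure.infinitePi fun i => labelLaw (p i)

instance (p : ℕ → I) : IsProbabilityMeasure (labelSeqLaw p) := by
  unfold labelSeqLaw; infer_instance

/-- Conditioning on the `i`-th label, expressed as a mixture: a revealed label is one whose bias has
become 1 or 0. A repeated request then needs no special treatment. -/
theorem labelSeqLaw_eq (p : ℕ → I) (i : ℕ) : labelSeqLaw p =
    ENNReal.ofReal (p i) • labelSeqLaw (Function.update p i 1) +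
      ENNReal.ofReal (1 - p i) • labelSeqLaw (Function.update p i 0) := by
  refine (Measure.eq_infinitePi _ fun s t ht => ?_).symm
  have hsum : ENNReal.ofReal (p i) + ENNReal.ofReal (1 - p i) = 1 := by
    rw [← ENNReal.ofReal_add (p i).2.1 (by linarith [(p i).2.2])]; simp
  simp only [Measure.add_apply, Measure.smul_apply, smul_eq_mul, labelSeqLaw]
  rw [Measure.infinitePi_pi _ fun i _ => ht i, Measure.infinitePi_pi _ fun i _ => ht i]
  by_cases hi : i ∈ s
  · rw [← Finset.mul_prod_erase s _ hi, ← Finset.mul_prod_erase s _ hi,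
      ← Finset.mul_prod_erase s _ hi]
    have h (b : I) : ∏ j ∈ s.erase i, labelLaw (Function.update p i b j) (t j) =
        ∏ j ∈ s.erase i, labelLaw (p j) (t j) :=
      Finset.prod_congr rfl fun j hj => by
        rw [Function.update_of_ne (Finset.ne_of_mem_erase hj)]
    rw [h, h, labelLaw_eq (p i)]
    simp only [Function.update_self, Measure.add_apply, Measure.smul_apply, smul_eq_mul]
    ring
  · have h (b : I) : ∏ j ∈ s, labelLaw (Function.update p i b j) (t j) =
        ∏ j ∈ s, labelLaw (p j) (t j) :=
      Finset.prod_congr rfl fun j hj => by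
        rw [Function.update_of_ne (ne_of_mem_of_not_mem hj hi)]
    rw [h, h, ← add_mul, hsum, one_mul]

theorem integral_labelSeqLaw (p : ℕ → I) (i : ℕ) {f : (ℕ → Label) → ℝ} (hf : Measurable f)
    {B : ℝ} (hB : ∀ y, |f y| ≤ B) : ∫ y, f y ∂labelSeqLaw p =
      (p i : ℝ) * ∫ y, f y ∂labelSeqLaw (Function.update p i 1) +
        (1 - p i) * ∫ y, f y ∂labelSeqLaw (Function.update p i 0) := by
  have hint (q : ℕ → I) : Integrable f (labelSeqLaw q) :=
    Integrable.of_bound hf.aestronglyMeasurable B (Eventually.of_forall hB)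
  conv_lhs => rw [labelSeqLaw_eq p i]
  rw [integral_add_measure ((hint _).smul_measure ENNReal.ofReal_ne_top)
    ((hint _).smul_measure ENNReal.ofReal_ne_top), integral_smul_measure, integral_smul_measure,
    ENNReal.toReal_ofReal (p i).2.1, ENNReal.toReal_ofReal (by linarith [(p i).2.2]),
    smul_eq_mul, smul_eq_mul]

theorem ae_eq_true_labelSeqLaw_update (p : ℕ → I) (i : ℕ) :
    ∀ᵐ y ∂labelSeqLaw (Function.update p i 1), y i = true := by
  have h : ∀ᵐ b ∂labelLaw (Function.update p i 1 i), b = true := by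
    rw [ae_iff]
    have : {b : Bool | ¬ b = true} = {false} := by ext b; simp
    rw [this, Function.update_self, labelLaw_false]; simp
  exact (measurePreserving_eval_infinitePi (fun j => labelLaw (Function.update p i 1 j))
    i).quasiMeasurePreserving.ae h

theorem ae_eq_false_labelSeqLaw_update (p : ℕ → I) (i : ℕ) :
    ∀ᵐ y ∂labelSeqLaw (Function.update p i 0), y i = false := by
  have h : ∀ᵐ b ∂labelLaw (Function.update p i 0 i), b = false := by
    rw [ae_iff]
    have : {b : Bool | ¬ b = false} = {true} := by ext b; simp
    rw [this, Function.update_self, labelLaw_true]; simp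
  exact (measurePreserving_eval_infinitePi (fun j => labelLaw (Function.update p i 0 j))
    i).quasiMeasurePreserving.ae h

/-! ## Interactive label requests -/

/-- One step of a querying strategy `nx` on the label sequence `y`. -/
def queryStep (nx : List Label → Option ℕ) (y : ℕ → Label) (L : List Label) : List Label :=
  match nx L with
  | none => L
  | some i => L ++ [y i]

theorem ActiveAlgorithm.received_eq_iterate {X : Type w} [MeasurableSpace X]
    (A : ActiveAlgorithm.{w, v} X) (n : ℕ) (r : A.Rand) (x : ℕ → X) (y : ℕ → Label) (t : ℕ) :
    A.received n r x y t = (queryStep (A.next n r x) y)^[t] [] := by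
  induction t with
  | zero => rfl
  | succ t ih =>
    rw [Function.iterate_succ_apply', ← ih]
    rfl

theorem queryStep_none {nx : List Label → Option ℕ} {L : List Label} (h : nx L = none)
    (y : ℕ → Label) : queryStep nx y L = L := by
  simp [queryStep, h]

theorem queryStep_some {nx : List Label → Option ℕ} {L : List Label} {i : ℕ} (h : nx L = some i)
    (y : ℕ → Label) : queryStep nx y L = L ++ [y i] := by
  simp [queryStep, h]

/-- With `m` requests the strategy explores a finite binary tree of label lists, so the result
depends on finitely many coordinates of `y`. Peeling off the first request rather than the last
makes the next index fixed instead of random. -/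
theorem measurable_iterate_queryStep (nx : List Label → Option ℕ) (F : List Label → ℝ) (m : ℕ)
    (L : List Label) : Measurable fun y : ℕ → Label => F ((queryStep nx y)^[m] L) := by
  induction m generalizing L with
  | zero =>
    simp only [Function.iterate_zero, id]
    exact measurable_const
  | succ m ih =>
    simp only [Function.iterate_succ_apply]
    cases h : nx L with
    | none => simpa only [queryStep_none h] using ih L
    | some i =>
      simp only [queryStep_some h]
      have : (fun y : ℕ → Label => F ((queryStep nx y)^[m] (L ++ [y i]))) = fun y =>
          if y i = true then F ((queryStep nx y)^[m] (L ++ [true]))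
          else F ((queryStep nx y)^[m] (L ++ [false])) := by
        funext y
        cases y i <;> simp
      rw [this]
      exact Measurable.ite (measurableSet_eq_fun (measurable_pi_apply i) measurable_const) (ih _) (ih _)

/-- The biases `p` and `q` agree, or have `χ²`-divergence at most `κ`. -/
def BiasClose (κ : ℝ) (p q : I) : Prop :=
  p = q ∨ 0 < (p : ℝ) ∧ (p : ℝ) < 1 ∧
    (q : ℝ) ^ 2 / p + (1 - q : ℝ) ^ 2 / (1 - p) ≤ 1 + κ

/-- Revealing a label puts the same bias 0 or 1 in both families. The alternative `p = q` in
`BiasClose` is there for this case, in which the divergence formula would divide by zero. -/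
theorem BiasClose.update {κ : ℝ} {p q : ℕ → I} (h : ∀ i, BiasClose κ (p i) (q i)) (j : ℕ) (b : I)
    (i : ℕ) : BiasClose κ (Function.update p j b i) (Function.update q j b i) := by
  by_cases hij : i = j
  · subst hij; left; simp
  · simpa [Function.update_of_ne hij] using h i

/-- A two-point testing bound for interactive label requests: no strategy with `m` requests
separates two close families of biases. -/
theorem two_point_bound (nx : List Label → Option ℕ) {F G : List Label → ℝ} {B κ s : ℝ}
    (hF : ∀ L, 0 ≤ F L) (hG : ∀ L, 0 ≤ G L) (hFB : ∀ L, F L ≤ B) (hGB : ∀ L, G L ≤ B)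
    (hFG : ∀ L, 1 ≤ F L + G L) (hκ : 0 ≤ κ) (hs : s ≤ 1 / 2) (m : ℕ)
    (L : List Label) (p q : ℕ → I) (hpq : ∀ i, BiasClose κ (p i) (q i)) (t : ℝ) (ht : 0 ≤ t) :
    2 * s * t - s ^ 2 * (1 + κ) ^ m * t ^ 2 ≤
      (∫ y, F ((queryStep nx y)^[m] L) ∂labelSeqLaw p) +
        t * ∫ y, G ((queryStep nx y)^[m] L) ∂labelSeqLaw q := by
  -- Here `t` plays the role of the likelihood ratio of `q` to `p` accumulated so far. If T is its
  -- final value, the right side is at least E_p[min(1, T)], and min(1, T) ≥ 2sT - s²T² for s ≤ 1/2.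
  -- Under `p`, T has mean `t` and second moment at most (1 + κ)^m t². The induction needs arbitrary
  -- `t` because each answer rescales it.
  induction m generalizing L p q t with
  | zero =>
    simp only [Function.iterate_zero, id, integral_const, probReal_univ, smul_eq_mul, one_mul,
      pow_zero, mul_one]
    rcases le_total t 1 with h | h
    · nlinarith [hFG L, hF L, mul_nonneg (sub_nonneg.2 h) (hF L),
        sq_nonneg (s * t), mul_le_mul_of_nonneg_right hs ht, mul_le_mul_of_nonneg_left (hFG L) ht]
    · nlinarith [hFG L, hG L, mul_nonneg (sub_nonneg.2 h) (hG L), sq_nonneg (s * t - 1)]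
  | succ m ih =>
    simp only [Function.iterate_succ_apply]
    have hK : (1 + κ) ^ m ≤ (1 + κ) ^ (m + 1) := pow_le_pow_right₀ (by linarith) (by omega)
    have hK0 : 0 ≤ s ^ 2 * (1 + κ) ^ m := by positivity
    cases h : nx L with
    | none =>
      simp only [queryStep_none h]
      refine le_trans ?_ (ih L p q hpq t ht)
      nlinarith [mul_le_mul_of_nonneg_left hK (mul_nonneg (sq_nonneg s) (sq_nonneg t))]
    | some i =>
      have key (H : List Label → ℝ) (hH : ∀ L, 0 ≤ H L) (hHB : ∀ L, H L ≤ B) (p : ℕ → I) :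
          ∫ y, H ((queryStep nx y)^[m] (queryStep nx y L)) ∂labelSeqLaw p =
          (p i : ℝ) * ∫ y, H ((queryStep nx y)^[m] (L ++ [true]))
            ∂labelSeqLaw (Function.update p i 1) +
          (1 - p i) * ∫ y, H ((queryStep nx y)^[m] (L ++ [false]))
            ∂labelSeqLaw (Function.update p i 0) := by
        rw [integral_labelSeqLaw p i (f := fun y => H ((queryStep nx y)^[m] (queryStep nx y L)))
          (measurable_iterate_queryStep nx H (m + 1) L)
          (fun y => (abs_of_nonneg (hH _)).trans_le (hHB _))]
        congr 2
        · refine integral_congr_ae ?_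
          filter_upwards [ae_eq_true_labelSeqLaw_update p i] with y hy
          rw [queryStep_some h, hy]
        · refine integral_congr_ae ?_
          filter_upwards [ae_eq_false_labelSeqLaw_update p i] with y hy
          rw [queryStep_some h, hy]
      rw [key F hF hFB, key G hG hGB]
      have ih1 := ih (L ++ [true]) _ _ (BiasClose.update hpq i 1)
      have ih0 := ih (L ++ [false]) _ _ (BiasClose.update hpq i 0)
      generalize (∫ y, F ((queryStep nx y)^[m] (L ++ [true]))
        ∂labelSeqLaw (Function.update p i 1)) = F1 at *
      generalize (∫ y, F ((queryStep nx y)^[m] (L ++ [false]))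
        ∂labelSeqLaw (Function.update p i 0)) = F0 at *
      generalize (∫ y, G ((queryStep nx y)^[m] (L ++ [true]))
        ∂labelSeqLaw (Function.update q i 1)) = G1 at *
      generalize (∫ y, G ((queryStep nx y)^[m] (L ++ [false]))
        ∂labelSeqLaw (Function.update q i 0)) = G0 at *
      have hp0 := (p i).2.1
      have hp1 := (p i).2.2
      rcases hpq i with he | ⟨h0, h1, hc⟩
      -- Equal biases: the answer is uninformative and `t` does not change.
      · rw [← he]
        have e1 := mul_le_mul_of_nonneg_left (ih1 t ht) hp0
        have e0 := mul_le_mul_of_nonneg_left (ih0 t ht) (sub_nonneg.2 hp1)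
        nlinarith [mul_le_mul_of_nonneg_left hK (mul_nonneg (sq_nonneg s) (sq_nonneg t))]
      · have hp1' : 0 < 1 - (p i : ℝ) := by linarith
        -- The induction hypothesis is used at `t` times the likelihood ratio of the answer: `q / p`
        -- for `+1`, `(1 - q) / (1 - p)` for `-1`. The weights `p i` and `1 - p i` then turn the `G`
        -- terms into those of `q`, and the quadratic terms sum to the divergence bounded by `hc`.
        have e1 := mul_le_mul_of_nonneg_left
          (ih1 (t * (q i / p i)) (mul_nonneg ht (div_nonneg (q i).2.1 hp0))) hp0
        have e0 := mul_le_mul_of_nonneg_left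
          (ih0 (t * ((1 - q i) / (1 - p i)))
            (mul_nonneg ht (div_nonneg (by linarith [(q i).2.2]) hp1'.le))) hp1'.le
        have r1 : (p i : ℝ) * (q i / p i) = q i := by field_simp
        have r0 : (1 - p i : ℝ) * ((1 - q i) / (1 - p i)) = 1 - q i := by field_simp
        have s1 : (p i : ℝ) * (q i / p i) ^ 2 = (q i) ^ 2 / p i := by field_simp
        have s0 : (1 - p i : ℝ) * ((1 - q i) / (1 - p i)) ^ 2 = (1 - q i) ^ 2 / (1 - p i) := by
          field_simp
        have e := mul_le_mul_of_nonneg_left hc (mul_nonneg hK0 (sq_nonneg t))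
        calc 2 * s * t - s ^ 2 * (1 + κ) ^ (m + 1) * t ^ 2
            = 2 * s * t - s ^ 2 * (1 + κ) ^ m * t ^ 2 * (1 + κ) := by ring
          _ ≤ 2 * s * t - s ^ 2 * (1 + κ) ^ m * t ^ 2 *
              ((q i : ℝ) ^ 2 / p i + (1 - q i : ℝ) ^ 2 / (1 - p i)) := by linarith
          _ = p i * (2 * s * (t * (q i / p i)) -
                s ^ 2 * (1 + κ) ^ m * (t * (q i / p i)) ^ 2) +
              (1 - p i) * (2 * s * (t * ((1 - q i) / (1 - p i))) -
                s ^ 2 * (1 + κ) ^ m * (t * ((1 - q i) / (1 - p i))) ^ 2) := by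
            rw [← s1, ← s0]
            linear_combination (-2 * s * t) * r1 + (-2 * s * t) * r0
          _ ≤ _ := add_le_add e1 e0
          _ = p i * F1 + (1 - p i) * F0 +
              t * ((p i * (q i / p i)) * G1 + ((1 - p i) * ((1 - q i) / (1 - p i))) * G0) := by
            ring
          _ = _ := by rw [r1, r0]

/-! ## Separating the unlabeled examples from the labels -/

/-- Lets an i.i.d. labeled sequence be realized from an i.i.d. sequence of instances and an
independent i.i.d. sequence of uniform seeds. The law of the labels given the instances is then
explicit, and Fubini replaces disintegration. -/
theorem map_prod_infinitePi {α β γ : Type*} [MeasurableSpace α] [MeasurableSpace β]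
    [MeasurableSpace γ] (μ : Measure α) [IsProbabilityMeasure μ] (ν : Measure β)
    [IsProbabilityMeasure ν] {f : α × β → γ} (hf : Measurable f) :
    ((Measure.infinitePi fun _ : ℕ => μ).prod (Measure.infinitePi fun _ : ℕ => ν)).map
      (fun w i => f (w.1 i, w.2 i)) = Measure.infinitePi fun _ : ℕ => (μ.prod ν).map f := by
  have : IsProbabilityMeasure ((μ.prod ν).map f) := Measure.isProbabilityMeasure_map hf.aemeasurable
  refine Measure.eq_infinitePi _ fun s t ht => ?_
  have hm : Measurable fun (w : (ℕ → α) × (ℕ → β)) (i : ℕ) => f (w.1 i, w.2 i) := by fun_prop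
  have hbox : MeasurableSet (Set.pi (s : Set ℕ) t) :=
    MeasurableSet.pi s.countable_toSet fun i _ => ht i
  rw [Measure.map_apply hm hbox, Measure.prod_apply (hm hbox)]
  have hsec (i : ℕ) (a : α) : MeasurableSet (Prod.mk a ⁻¹' (f ⁻¹' t i)) :=
    measurable_prodMk_left (hf (ht i))
  have hg (i : ℕ) : Measurable fun a => ν (Prod.mk a ⁻¹' (f ⁻¹' t i)) :=
    measurable_measure_prodMk_left (hf (ht i))
  have h1 (x : ℕ → α) : (Measure.infinitePi fun _ : ℕ => ν)
      (Prod.mk x ⁻¹' ((fun (w : (ℕ → α) × (ℕ → β)) (i : ℕ) => f (w.1 i, w.2 i)) ⁻¹'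
        Set.pi (s : Set ℕ) t)) = ∏ i ∈ s, ν (Prod.mk (x i) ⁻¹' (f ⁻¹' t i)) := by
    rw [← Measure.infinitePi_pi (fun _ : ℕ => ν) fun i _ => hsec i (x i)]
    rfl
  simp only [h1]
  have hind := ProbabilityTheory.iIndepFun_infinitePi (P := fun _ : ℕ => μ)
    (X := fun i a => ν (Prod.mk a ⁻¹' (f ⁻¹' t i))) (fun i => hg i)
  rw [ProbabilityTheory.lintegral_prod_eq_prod_lintegral_of_indepFun s _ hind
    fun i => (hg i).comp (measurable_pi_apply i)]
  refine Finset.prod_congr rfl fun i _ => ?_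
  rw [Measure.map_apply hf (ht i), Measure.prod_apply (hf (ht i)),
    ← (measurePreserving_eval_infinitePi (fun _ : ℕ => μ) i).lintegral_comp (hg i)]

/-! ## Error rates and the conditional label distribution -/

section ErrorRate

variable {X : Type w} [MeasurableSpace X]

theorem Classifier.measurableSet_ne (h g : Classifier X) : MeasurableSet {x | h.1 x ≠ g.1 x} :=
  (measurableSet_eq_fun h.2 g.2).compl

theorem Classifier.measurableSet_eq_true (h : Classifier X) : MeasurableSet {x | h.1 x = true} :=
  h.2 (measurableSet_singleton true)

theorem errorRate_nonneg (P : JointDist X) (h : Classifier X) : 0 ≤ errorRate P h :=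
  measureReal_nonneg

theorem errorRate_le_one (P : JointDist X) (h : Classifier X) : errorRate P h ≤ 1 :=
  measureReal_le_one

theorem IsCondLabelDist.integrable {P : JointDist X} {η : X → ℝ} (hη : IsCondLabelDist P η) :
    Integrable η (P : Measure (X × Label)).fst :=
  Integrable.of_bound hη.1.aestronglyMeasurable 1 (Eventually.of_forall fun x => by
    rw [Real.norm_of_nonneg (hη.2.1 x).1]; exact (hη.2.1 x).2)

theorem IsCondLabelDist.measureReal_prod_false {P : JointDist X} {η : X → ℝ}
    (hη : IsCondLabelDist P η) {A : Set X} (hA : MeasurableSet A) :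
    (P : Measure (X × Label)).real (A ×ˢ {false}) =
      ∫ x in A, (1 - η x) ∂(P : Measure (X × Label)).fst := by
  have hu : A ×ˢ (univ : Set Label) = A ×ˢ {true} ∪ A ×ˢ {false} := by
    rw [← prod_union]; congr; ext b; cases b <;> simp
  have hd : Disjoint (A ×ˢ {true} : Set (X × Label)) (A ×ˢ {false}) := by
    rw [Set.disjoint_prod]; right; simp
  have hfst : (P : Measure (X × Label)).fst.real A =
      (P : Measure (X × Label)).real (A ×ˢ (univ : Set Label)) := by
    rw [measureReal_def, measureReal_def, Measure.fst_apply hA]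
    congr 2; ext; simp
  rw [integral_sub (integrable_const _) hη.integrable.integrableOn, ← hη.2.2 A hA,
    setIntegral_const, hfst, hu,
    measureReal_union hd (hA.prod (measurableSet_singleton _))]
  simp

theorem errorRate_eq_integral {P : JointDist X} {η : X → ℝ} (hη : IsCondLabelDist P η)
    (h : Classifier X) : errorRate P h =
      ∫ x, (if h.1 x = true then 1 - η x else η x) ∂(P : Measure (X × Label)).fst := by
  have hT := h.measurableSet_eq_true
  have hset : {q : X × Label | h.1 q.1 ≠ q.2} =
      {x | h.1 x = true}ᶜ ×ˢ {true} ∪ {x | h.1 x = true} ×ˢ {false} := by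
    ext ⟨x, b⟩; cases hx : h.1 x <;> cases b <;> simp [hx]
  have hd : Disjoint ({x | h.1 x = true}ᶜ ×ˢ {true} : Set (X × Label))
      ({x | h.1 x = true} ×ˢ {false}) := by
    rw [Set.disjoint_prod]; right; simp
  have hint : Integrable (fun x => if h.1 x = true then 1 - η x else η x)
      (P : Measure (X × Label)).fst :=
    Integrable.of_bound (Measurable.ite hT (measurable_const.sub hη.1) hη.1).aestronglyMeasurable 1
      (Eventually.of_forall fun x => by
        have := hη.2.1 x
        rw [Real.norm_eq_abs, abs_le]
        split_ifs <;> constructor <;> linarith [this.1, this.2])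
  rw [errorRate, hset, measureReal_union hd (hT.prod (measurableSet_singleton _)),
    hη.2.2 _ hT.compl, hη.measureReal_prod_false hT, ← integral_add_compl hT hint, add_comm]
  congr 1
  · exact setIntegral_congr_fun hT fun x hx => by simp_all
  · exact setIntegral_congr_fun hT.compl fun x hx => by simp_all

/-- The excess error of a classifier over the Bayes classifier `g`. -/
theorem errorRate_eq_add_setIntegral {P : JointDist X} {η : X → ℝ} (hη : IsCondLabelDist P η)
    {g : Classifier X} (hg : ∀ x, g.1 x = true ↔ 1 / 2 ≤ η x) (h : Classifier X) :
    errorRate P h = errorRate P g +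
      ∫ x in {x | h.1 x ≠ g.1 x}, |2 * η x - 1| ∂(P : Measure (X × Label)).fst := by
  have hint (f : Classifier X) : Integrable (fun x => if f.1 x = true then 1 - η x else η x)
      (P : Measure (X × Label)).fst :=
    Integrable.of_bound (Measurable.ite f.measurableSet_eq_true (measurable_const.sub hη.1)
      hη.1).aestronglyMeasurable 1 (Eventually.of_forall fun x => by
        have := hη.2.1 x
        rw [Real.norm_eq_abs, abs_le]
        split_ifs <;> constructor <;> linarith [this.1, this.2])
  rw [← sub_eq_iff_eq_add', errorRate_eq_integral hη, errorRate_eq_integral hη,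
    ← integral_sub (hint h) (hint g), ← integral_indicator (h.measurableSet_ne g)]
  refine integral_congr_ae (Eventually.of_forall fun x => ?_)
  have hgx := hg x
  simp only [Set.indicator, mem_ofPred_eq]
  rcases hh : h.1 x <;> rcases hgg : g.1 x <;> simp only [hgg] at hgx ⊢ <;> simp
  · rw [abs_of_nonneg (by linarith [hgx.1 trivial])]; ring
  · have : ¬ (1 / 2 ≤ η x) := fun h => by simpa using hgx.2 h
    rw [abs_of_nonpos (by linarith)]; ring

theorem errorRate_le_half {P : JointDist X} {η : X → ℝ} (hη : IsCondLabelDist P η)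
    {g : Classifier X} (hg : ∀ x, g.1 x = true ↔ 1 / 2 ≤ η x) : errorRate P g ≤ 1 / 2 := by
  rw [errorRate_eq_integral hη]
  have : ∫ x, (1 / 2 : ℝ) ∂(P : Measure (X × Label)).fst = 1 / 2 := by simp
  rw [← this]
  refine integral_mono_of_nonneg (Eventually.of_forall fun x => ?_) (integrable_const _)
    (Eventually.of_forall fun x => ?_)
  · have := hη.2.1 x
    dsimp only [Pi.zero_apply]
    split_ifs <;> linarith [this.1, this.2]
  · dsimp only
    split_ifs with h
    · linarith [(hg x).1 h]
    · rw [hg x] at h; linarith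

end ErrorRate

/-! ## The hard family -/

/-- The regression function of the member of the hard family with `η(0) = θ`. -/
noncomputable def hardEta (θ : ℝ) (x : I) : ℝ := θ + (x : ℝ) / 2 * (1 - θ)

/-- The threshold at which `hardEta θ` crosses `1/2`. -/
noncomputable def crossing (θ : ℝ) : ℝ := (1 - 2 * θ) / (1 - θ)

/-- `P` is the member of the hard family with `η(0) = θ`. -/
structure IsHard (P : JointDist I) (θ : ℝ) : Prop where
  fst_eq : (P : Measure (I × Label)).fst = halfAtomMarginal
  cond : IsCondLabelDist P (hardEta θ)
  mem : θ ∈ Ioo (1 / 8 : ℝ) (3 / 8)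

/-- The version of η in the definition is prescribed at every x > 0, so it coincides everywhere with
`hardEta (η 0)` and the family has one real parameter. -/
theorem mem_hardFamily_iff {P : JointDist I} : P ∈ hardFamily ↔ ∃ θ, IsHard P θ := by
  constructor
  · rintro ⟨h1, η, h2, h3, h4⟩
    refine ⟨η 0, h1, ?_, h3⟩
    have : hardEta (η 0) = η := by
      funext x
      rcases eq_or_lt_of_le (unitInterval.nonneg' (t := x)) with h | h
      · rw [← h]; simp [hardEta]
      · rw [h4 x h, hardEta]
    rwa [this]
  · rintro ⟨θ, h⟩
    refine ⟨h.fst_eq, hardEta θ, h.cond, ?_, fun x _ => ?_⟩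
    · simpa [hardEta] using h.mem
    · simp [hardEta]

theorem crossing_mem {θ : ℝ} (hθ : θ ∈ Icc (1 / 8 : ℝ) (3 / 8)) :
    crossing θ ∈ Ioo (0 : ℝ) 1 := by
  have h : 0 < 1 - θ := by linarith [hθ.2]
  rw [crossing, mem_Ioo, lt_div_iff₀ h, div_lt_iff₀ h]
  constructor <;> linarith [hθ.1, hθ.2]

theorem crossing_sub {θ θ' : ℝ} (hθ : θ < 1) (hθ' : θ' < 1) :
    crossing θ - crossing θ' = (θ' - θ) / ((1 - θ) * (1 - θ')) := by
  have h : 1 - θ ≠ 0 := by linarith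
  have h' : 1 - θ' ≠ 0 := by linarith
  rw [crossing, crossing]; field_simp; ring

theorem sq_crossing_sub_le {θ θ' : ℝ} (hθ : θ ∈ Icc (1 / 8 : ℝ) (3 / 8))
    (hθ' : θ' ∈ Icc (1 / 8 : ℝ) (3 / 8)) :
    (crossing θ - crossing θ') ^ 2 ≤ 7 * (θ - θ') ^ 2 := by
  have h : 5 / 8 ≤ 1 - θ := by linarith [hθ.2]
  have h' : 5 / 8 ≤ 1 - θ' := by linarith [hθ'.2]
  have hm : 25 / 64 ≤ (1 - θ) * (1 - θ') := by nlinarith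
  rw [crossing_sub (by linarith [hθ.2]) (by linarith [hθ'.2]), div_pow,
    div_le_iff₀ (by positivity)]
  nlinarith [sq_nonneg (θ - θ'), mul_le_mul hm hm (by norm_num) (by linarith)]

/-- The margin is linear around the crossing, which makes the excess error quadratic in the
displacement of the threshold. -/
theorem hardEta_sub (θ : ℝ) (hθ : θ < 1) (x : I) :
    2 * hardEta θ x - 1 = (1 - θ) * (x - crossing θ) := by
  have h : 1 - θ ≠ 0 := by linarith
  rw [hardEta, crossing]; field_simp; ring

theorem thresholdClassifier_apply (z : ℝ) (x : I) :
    (thresholdClassifier z).1 x = true ↔ z ≤ (x : ℝ) := by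
  simp [thresholdClassifier]

theorem thresholdClassifier_crossing {θ : ℝ} (hθ : θ < 1) (x : I) :
    (thresholdClassifier (crossing θ)).1 x = true ↔ 1 / 2 ≤ hardEta θ x := by
  have h := hardEta_sub θ hθ x
  rw [thresholdClassifier_apply]
  constructor
  · intro hx
    nlinarith [mul_nonneg (sub_nonneg.2 hθ.le) (sub_nonneg.2 hx)]
  · intro hx
    by_contra hc
    nlinarith [mul_pos (sub_pos.2 hθ) (sub_pos.2 (not_le.1 hc))]

namespace IsHard

variable {P : JointDist I} {θ : ℝ}

theorem lt_one (h : IsHard P θ) : θ < 1 := by linarith [h.mem.2]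

theorem errorRate_eq (hP : IsHard P θ) (h : Classifier I) :
    errorRate P h = errorRate P (thresholdClassifier (crossing θ)) +
      ∫ x in {x | h.1 x ≠ (thresholdClassifier (crossing θ)).1 x},
        (1 - θ) * |(x : ℝ) - crossing θ| ∂halfAtomMarginal := by
  rw [errorRate_eq_add_setIntegral hP.cond (thresholdClassifier_crossing hP.lt_one), hP.fst_eq]
  congr 1
  refine integral_congr_ae (Eventually.of_forall fun x => ?_)
  dsimp only
  rw [hardEta_sub θ hP.lt_one, abs_mul, abs_of_pos (sub_pos.2 hP.lt_one)]

theorem le_errorRate (hP : IsHard P θ) (h : Classifier I) :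
    errorRate P (thresholdClassifier (crossing θ)) ≤ errorRate P h := by
  rw [hP.errorRate_eq h, le_add_iff_nonneg_right]
  exact integral_nonneg fun x => mul_nonneg (sub_nonneg.2 hP.lt_one.le) (abs_nonneg _)

/-- The Bayes classifier is itself a threshold with parameter in (0, 1), so the noise rate is the
Bayes error and no classifier, inside the class or not, falls below it. -/
theorem noiseRate_eq (hP : IsHard P θ) :
    noiseRate thresholdClass P = errorRate P (thresholdClassifier (crossing θ)) := by
  have hmem : thresholdClassifier (crossing θ) ∈ thresholdClass :=
    ⟨_, crossing_mem (Ioo_subset_Icc_self hP.mem), rfl⟩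
  have : Nonempty thresholdClass := ⟨⟨_, hmem⟩⟩
  refine le_antisymm ?_ (le_ciInf fun h => hP.le_errorRate h.1)
  exact ciInf_le (f := fun h : thresholdClass => errorRate P h.1)
    ⟨0, by rintro _ ⟨h, rfl⟩; exact errorRate_nonneg _ _⟩ ⟨_, hmem⟩

theorem noiseRate_nonneg (hP : IsHard P θ) : 0 ≤ noiseRate thresholdClass P := by
  rw [hP.noiseRate_eq]; exact errorRate_nonneg _ _

theorem noiseRate_le_half (hP : IsHard P θ) : noiseRate thresholdClass P ≤ 1 / 2 := by
  rw [hP.noiseRate_eq]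
  exact errorRate_le_half hP.cond (thresholdClassifier_crossing hP.lt_one)

end IsHard

/-! ### Excess error of thresholds, and separation of two members of the family. -/

theorem halfAtomMarginal_Ico {a b : I} (ha : 0 < a) (hab : a ≤ b) :
    halfAtomMarginal.real (Ico a b) = ((b : ℝ) - a) / 2 := by
  have h0 : (0 : I) ∉ Ico a b := fun h => absurd h.1 (not_le.2 ha)
  have : (0 : ℝ) ≤ (b : ℝ) - a := sub_nonneg.2 hab
  simp only [measureReal_def, halfAtomMarginal, Measure.add_apply, Measure.smul_apply, smul_eq_mul,
    Measure.dirac_apply' _ measurableSet_Ico, unitInterval.volume_Ico]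
  simp [h0, this]
  ring

instance : IsProbabilityMeasure halfAtomMarginal := ⟨by
  simp [halfAtomMarginal, ENNReal.inv_two_add_inv_two]⟩

/-- The points at which two threshold classifiers differ. -/
theorem ne_thresholdClassifier (a b : I) :
    {x | (thresholdClassifier a).1 x ≠ (thresholdClassifier b).1 x} =
      Ico (min a b) (max a b) := by
  ext x
  have ha := thresholdClassifier_apply a x
  have hb := thresholdClassifier_apply b x
  simp only [mem_ofPred_eq, mem_Ico, min_le_iff, lt_max_iff, Subtype.coe_le_coe, ne_eq] at *
  rw [Bool.eq_iff_iff, ha, hb, ← not_le, ← not_le]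
  tauto

theorem IsHard.errorRate_thresholdClassifier_le {P : JointDist I} {θ z : ℝ} (hP : IsHard P θ)
    (hz : z ∈ Ioo (0 : ℝ) 1) :
    errorRate P (thresholdClassifier z) ≤
      noiseRate thresholdClass P + (z - crossing θ) ^ 2 / 2 := by
  rw [hP.noiseRate_eq, hP.errorRate_eq (thresholdClassifier z), add_le_add_iff_left]
  have hc := crossing_mem (Ioo_subset_Icc_self hP.mem)
  let a : I := ⟨z, hz.1.le, hz.2.le⟩
  let b : I := ⟨crossing θ, hc.1.le, hc.2.le⟩
  have hset := ne_thresholdClassifier a b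
  have hab : 0 < min a b := lt_min hz.1 hc.1
  change ∫ x in {x | (thresholdClassifier a).1 x ≠ (thresholdClassifier b).1 x}, _ ∂_ ≤ _
  rw [hset]
  have hdist : ((max a b : I) : ℝ) - (min a b : I) = |z - crossing θ| := by
    rcases le_total a b with h | h
    · rw [max_eq_right h, min_eq_left h, abs_sub_comm, abs_of_nonneg (sub_nonneg.2 (by exact h))]
    · rw [max_eq_left h, min_eq_right h, abs_of_nonneg (sub_nonneg.2 (by exact h))]
  -- The disagreement interval avoids the atom because both thresholds are positive. Its mass is
  -- half its length, and the margin on it is at most its length.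
  calc ∫ x in Ico (min a b) (max a b), (1 - θ) * |(x : ℝ) - crossing θ| ∂halfAtomMarginal
      ≤ ∫ x in Ico (min a b) (max a b), |z - crossing θ| ∂halfAtomMarginal := by
        refine setIntegral_mono_on ?_ (integrable_const _) measurableSet_Ico fun x hx => ?_
        · refine (Integrable.of_bound (C := 1) (by fun_prop)
            (Eventually.of_forall fun x => ?_)).integrableOn
          rw [norm_mul, Real.norm_of_nonneg (by linarith [hP.lt_one]), Real.norm_eq_abs, abs_abs]
          have : |(x : ℝ) - crossing θ| ≤ 1 := abs_le.2 ⟨by linarith [x.2.1, hc.2],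
            by linarith [x.2.2, hc.1]⟩
          nlinarith [abs_nonneg ((x : ℝ) - crossing θ), hP.mem.1, hP.mem.2]
        · have h1 : |(x : ℝ) - crossing θ| ≤ |z - crossing θ| := by
            rw [← hdist, abs_le]
            have e1 : ((min a b : I) : ℝ) ≤ x := hx.1
            have e2 : (x : ℝ) ≤ (max a b : I) := hx.2.le
            have e3 : ((min a b : I) : ℝ) ≤ crossing θ := min_le_right a b
            have e4 : crossing θ ≤ (max a b : I) := le_max_right a b
            constructor <;> linarith
          nlinarith [abs_nonneg ((x : ℝ) - crossing θ), hP.mem.1, hP.mem.2]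
    _ = (z - crossing θ) ^ 2 / 2 := by
        rw [setIntegral_const, halfAtomMarginal_Ico hab min_le_max, hdist, smul_eq_mul,
          ← sq_abs (z - crossing θ)]
        ring

theorem mul_measureReal_le_setIntegral {α : Type*} [MeasurableSpace α] {μ : Measure α}
    [IsFiniteMeasure μ] {f : α → ℝ} (hf : Integrable f μ) (h0 : ∀ x, 0 ≤ f x) {S T : Set α}
    (hST : S ⊆ T) (hS : MeasurableSet S) {c : ℝ} (hc : ∀ x ∈ S, c ≤ f x) :
    c * μ.real S ≤ ∫ x in T, f x ∂μ := by
  calc c * μ.real S = ∫ _ in S, c ∂μ := by rw [setIntegral_const, smul_eq_mul, mul_comm]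
    _ ≤ ∫ x in S, f x ∂μ := setIntegral_mono_on (integrable_const _) hf.integrableOn hS hc
    _ ≤ _ := setIntegral_mono_set hf.integrableOn (Eventually.of_forall h0) hST.eventuallyLE

theorem integrable_mul_abs_sub (a c : ℝ) :
    Integrable (fun x : I => a * |(x : ℝ) - c|) halfAtomMarginal :=
  Integrable.of_bound (C := |a| * (1 + |c|)) (by fun_prop)
    (Eventually.of_forall fun x => by
      rw [norm_mul, Real.norm_eq_abs, Real.norm_eq_abs, abs_abs]
      gcongr
      exact (abs_sub _ _).trans (by gcongr; exact abs_le.2 ⟨by linarith [x.2.1], x.2.2⟩))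

/-- No classifier is nearly optimal for two members of the hard family. -/
theorem IsHard.sq_le_excess_add_excess {P Q : JointDist I} {θ θ' : ℝ} (hP : IsHard P θ)
    (hQ : IsHard Q θ') (hlt : θ < θ') (h : Classifier I) :
    (θ' - θ) ^ 2 / 30 ≤ (errorRate P h - noiseRate thresholdClass P) +
      (errorRate Q h - noiseRate thresholdClass Q) := by
  have hz := crossing_mem (Ioo_subset_Icc_self hP.mem)
  have hz' := crossing_mem (Ioo_subset_Icc_self hQ.mem)
  rw [hP.noiseRate_eq, hQ.noiseRate_eq, hP.errorRate_eq h, hQ.errorRate_eq h,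
    add_sub_cancel_left, add_sub_cancel_left]
  have hΔ : θ' - θ ≤ crossing θ - crossing θ' := by
    have h1 := hP.mem
    have h2 := hQ.mem
    rw [crossing_sub hP.lt_one hQ.lt_one, le_div_iff₀
      (mul_pos (sub_pos.2 hP.lt_one) (sub_pos.2 hQ.lt_one))]
    have : (1 - θ) * (1 - θ') ≤ 1 := by nlinarith [h1.1, h1.2, h2.1, h2.2]
    nlinarith
  set z := crossing θ
  set z' := crossing θ'
  have hd : 0 < z - z' := by linarith
  -- `Ico a b` is the middle third between the two crossings. There the two Bayes classifiers
  -- differ, so `h` errs against at least one of them, and both margins are at least 5/8 · (z -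
  -- z')/3.
  let a : I := ⟨z' + (z - z') / 3, by linarith [hz'.1], by linarith [hz.2]⟩
  let b : I := ⟨z - (z - z') / 3, by linarith [hz'.1], by linarith [hz.2]⟩
  have ha : (a : ℝ) = z' + (z - z') / 3 := rfl
  have hb : (b : ℝ) = z - (z - z') / 3 := rfl
  have hab : a ≤ b := Subtype.coe_le_coe.1 (by rw [ha, hb]; linarith)
  have ha0 : 0 < a := Subtype.coe_lt_coe.1 (by rw [ha]; simp; linarith [hz'.1])
  have hmS := halfAtomMarginal_Ico ha0 hab
  have hmA := h.measurableSet_ne (thresholdClassifier z)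
  have hmB := h.measurableSet_ne (thresholdClassifier z')
  have hmem (x : I) (hx : x ∈ Ico a b) : z' + (z - z') / 3 ≤ (x : ℝ) ∧
      (x : ℝ) < z - (z - z') / 3 := hx
  have e1 := mul_measureReal_le_setIntegral (integrable_mul_abs_sub (1 - θ) z)
    (fun x => mul_nonneg (sub_nonneg.2 hP.lt_one.le) (abs_nonneg _))
    (inter_subset_left (t := Ico a b)) (hmA.inter measurableSet_Ico)
    (c := 5 / 8 * ((z - z') / 3)) fun x hx => by
      have h1 := hmem x hx.2
      have h2 : (z - z') / 3 ≤ |(x : ℝ) - z| := by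
        rw [abs_sub_comm]; exact le_trans (by linarith) (le_abs_self _)
      exact mul_le_mul (by linarith [hP.mem.2]) h2 (by positivity) (by linarith [hP.mem.2])
  have e2 := mul_measureReal_le_setIntegral (integrable_mul_abs_sub (1 - θ') z')
    (fun x => mul_nonneg (sub_nonneg.2 hQ.lt_one.le) (abs_nonneg _))
    (inter_subset_left (t := Ico a b)) (hmB.inter measurableSet_Ico)
    (c := 5 / 8 * ((z - z') / 3)) fun x hx => by
      have h1 := hmem x hx.2
      have h2 : (z - z') / 3 ≤ |(x : ℝ) - z'| := le_trans (by linarith) (le_abs_self _)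
      exact mul_le_mul (by linarith [hQ.mem.2]) h2 (by positivity) (by linarith [hQ.mem.2])
  have hcov : Ico a b ⊆ {x | h.1 x ≠ (thresholdClassifier z).1 x} ∩ Ico a b ∪
      {x | h.1 x ≠ (thresholdClassifier z').1 x} ∩ Ico a b := by
    intro x hx
    have h1 := hmem x hx
    have t1 : (thresholdClassifier z).1 x = false := by
      rw [← Bool.not_eq_true, thresholdClassifier_apply]; linarith
    have t2 : (thresholdClassifier z').1 x = true := by
      rw [thresholdClassifier_apply]; linarith
    cases hh : h.1 x
    · right; exact ⟨by simp [hh, t2], hx⟩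
    · left; exact ⟨by simp [hh, t1], hx⟩
  have hμ : halfAtomMarginal.real (Ico a b) ≤ _ := (measureReal_mono hcov).trans
    (measureReal_union_le _ _)
  rw [hmS, ha, hb] at hμ
  have e3 := mul_le_mul_of_nonneg_left hμ (show 0 ≤ 5 / 8 * ((z - z') / 3) by positivity)
  -- The margin bound times the mass (z - z')/6 of the middle third gives 5/144 · (z - z')², and
  -- 5/144 ≥ 1/30.
  have e4 : (θ' - θ) ^ 2 ≤ (z - z') ^ 2 := pow_le_pow_left₀ (by linarith) hΔ 2
  nlinarith

/-! ## Existence of the members of the hard family -/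

theorem hardEta_mem (θ x : I) : hardEta θ x ∈ I := by
  have h1 := θ.2; have h2 := x.2
  rw [hardEta]
  constructor
  · nlinarith [h1.1, h1.2, h2.1, h2.2, mul_nonneg h2.1 (sub_nonneg.2 h1.2)]
  · nlinarith [h1.1, h1.2, h2.1, h2.2, mul_nonneg (sub_nonneg.2 h2.2) (sub_nonneg.2 h1.2)]

/-- `hardEta` as a function to the unit interval. -/
noncomputable def hardBias (θ x : I) : I := ⟨hardEta θ x, hardEta_mem θ x⟩

theorem measurable_hardEta (θ : ℝ) : Measurable (hardEta θ) := by
  unfold hardEta; fun_prop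

theorem measurable_hardBias (θ : I) : Measurable (hardBias θ) :=
  (measurable_hardEta θ).subtype_mk

/-- Label the instance `w.1`, with `w.2` as a source of randomness. -/
noncomputable def hardLabel (θ : I) (w : I × I) : I × Label :=
  (w.1, decide (w.2 ≤ hardBias θ w.1))

theorem measurable_hardLabel (θ : I) : Measurable (hardLabel θ) :=
  measurable_fst.prodMk
    (measurable_decide_le measurable_snd ((measurable_hardBias θ).comp measurable_fst))

/-- The member of the hard family with `η(0) = θ`. -/
noncomputable def hardDist (θ : I) : JointDist I :=
  ⟨(halfAtomMarginal.prod volume).map (hardLabel θ),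
    Measure.isProbabilityMeasure_map (measurable_hardLabel θ).aemeasurable⟩

theorem coe_hardDist (θ : I) :
    (hardDist θ : Measure (I × Label)) = (halfAtomMarginal.prod volume).map (hardLabel θ) := rfl

theorem fst_hardDist (θ : I) : (hardDist θ : Measure (I × Label)).fst = halfAtomMarginal := by
  rw [coe_hardDist, Measure.fst, Measure.map_map measurable_fst (measurable_hardLabel θ)]
  exact Measure.fst_prod

theorem isHard_hardDist {θ : I} (hθ : (θ : ℝ) ∈ Ioo (1 / 8 : ℝ) (3 / 8)) :
    IsHard (hardDist θ) θ := by
  refine ⟨fst_hardDist θ, ⟨measurable_hardEta _, fun x => hardEta_mem θ x, fun A hA => ?_⟩, hθ⟩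
  have hm : MeasurableSet (A ×ˢ ({true} : Set Label)) := hA.prod (measurableSet_singleton _)
  have hsec (x : I) : volume (Prod.mk x ⁻¹' (hardLabel θ ⁻¹' (A ×ˢ ({true} : Set Label)))) =
      A.indicator (fun x => ENNReal.ofReal (hardEta θ x)) x := by
    by_cases hx : x ∈ A
    · have : Prod.mk x ⁻¹' (hardLabel θ ⁻¹' (A ×ˢ ({true} : Set Label))) = Iic (hardBias θ x) := by
        ext u; simp [hardLabel, hx]
      rw [this, unitInterval.volume_Iic, indicator_of_mem hx, hardBias]
    · have : Prod.mk x ⁻¹' (hardLabel θ ⁻¹' (A ×ˢ ({true} : Set Label))) = ∅ := by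
        ext u; simp [hardLabel, hx]
      rw [this, measure_empty, indicator_of_notMem hx]
  rw [fst_hardDist, measureReal_def, coe_hardDist, Measure.map_apply (measurable_hardLabel θ) hm,
    Measure.prod_apply (measurable_hardLabel θ hm)]
  simp only [hsec]
  rw [lintegral_indicator hA, integral_eq_lintegral_of_nonneg_ae
    (Eventually.of_forall fun x => (hardEta_mem θ x).1)
    (measurable_hardEta _).aestronglyMeasurable]

theorem biasClose_hardBias {θ θ' : I} (hθ : (θ : ℝ) ∈ Ioo (1 / 8 : ℝ) (3 / 8)) (x : I) :
    BiasClose (10 * ((θ' : ℝ) - θ) ^ 2) (hardBias θ x) (hardBias θ' x) := by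
  right
  have hx0 := x.2.1
  have hx1 := x.2.2
  have hp0 : 1 / 8 ≤ hardEta θ x := by
    rw [hardEta]
    nlinarith [hθ.1, hθ.2, mul_nonneg hx0 (show 0 ≤ 1 - (θ : ℝ) by linarith [hθ.2])]
  have hp1 : hardEta θ x ≤ 11 / 16 := by
    rw [hardEta]
    nlinarith [hθ.1, hθ.2, mul_nonneg (sub_nonneg.2 hx1) (show 0 ≤ 1 - (θ : ℝ) by linarith [hθ.2])]
  have hqp : hardEta θ' x - hardEta θ x = ((θ' : ℝ) - θ) * (1 - x / 2) := by
    rw [hardEta, hardEta]; ring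
  change 0 < hardEta θ x ∧ hardEta θ x < 1 ∧ _
  refine ⟨by linarith, by linarith, ?_⟩
  change hardEta θ' x ^ 2 / hardEta θ x + (1 - hardEta θ' x) ^ 2 / (1 - hardEta θ x) ≤ _
  set p := hardEta θ x
  set q := hardEta θ' x
  have h0 : 0 < p := by linarith
  have h1 : 0 < 1 - p := by linarith
  have e : q ^ 2 / p + (1 - q) ^ 2 / (1 - p) = 1 + (q - p) ^ 2 / (p * (1 - p)) := by
    field_simp; ring
  -- On [1/8, 11/16] the minimum of p(1 - p) is 7/64, attained at 1/8. This is the source of the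
  -- factor 10.
  have hv : 1 / 10 ≤ p * (1 - p) := by nlinarith
  have hsq : (q - p) ^ 2 ≤ ((θ' : ℝ) - θ) ^ 2 := by
    rw [hqp, mul_pow]
    have : (1 - (x : ℝ) / 2) ^ 2 ≤ 1 := by nlinarith
    nlinarith [sq_nonneg ((θ' : ℝ) - θ)]
  rw [e, add_le_add_iff_left, div_le_iff₀ (by positivity)]
  nlinarith [sq_nonneg ((θ' : ℝ) - θ)]

/-! ## The expected error of active algorithms -/

theorem measurable_errorRate {X : Type w} [MeasurableSpace X] (P : JointDist X) {α : Type*}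
    [MeasurableSpace α] {f : α → Classifier X} (hf : Measurable fun p : α × X => (f p.1).1 p.2) :
    Measurable fun a => errorRate P (f a) := by
  have hm : MeasurableSet {w : α × (X × Label) | (f w.1).1 w.2.1 ≠ w.2.2} :=
    (measurableSet_eq_fun
      (hf.comp (measurable_fst.prodMk (measurable_fst.comp measurable_snd)))
      (measurable_snd.comp measurable_snd)).compl
  exact (measurable_measure_prodMk_left (ν := (P : Measure (X × Label))) hm).ennreal_toReal

namespace ActiveAlgorithm

variable {X : Type w} [MeasurableSpace X] (A : ActiveAlgorithm.{w, v} X)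

/-- The list received before and the index requested next range over countable types, so one may
split over their values; for fixed values the condition involves a single label. -/
theorem measurableSet_received_eq (n t : ℕ) (L : List Label) :
    MeasurableSet {p : A.Rand × (ℕ → X × Label) |
      A.received n p.1 (fun i => (p.2 i).1) (fun i => (p.2 i).2) t = L} := by
  induction t generalizing L with
  | zero =>
    have : {p : A.Rand × (ℕ → X × Label) |
      A.received n p.1 (fun i => (p.2 i).1) (fun i => (p.2 i).2) 0 = L} = {_p | [] = L} := rfl
    rw [this]; exact MeasurableSet.const _
  | succ t ih =>
    have hx : Measurable fun p : A.Rand × (ℕ → X × Label) => (p.1, fun i => (p.2 i).1) := by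
      fun_prop
    have : {p : A.Rand × (ℕ → X × Label) |
        A.received n p.1 (fun i => (p.2 i).1) (fun i => (p.2 i).2) (t + 1) = L} =
        ⋃ (K : List Label) (o : Option ℕ), {p : A.Rand × (ℕ → X × Label) |
          A.received n p.1 (fun i => (p.2 i).1) (fun i => (p.2 i).2) t = K} ∩
          ({p | A.next n p.1 (fun i => (p.2 i).1) K = o} ∩
          {p | (match o with
            | none => K
            | some i => K ++ [(p.2 i).2]) = L}) := by
      ext p
      simp only [mem_iUnion, mem_inter_iff, mem_ofPred_eq]
      constructor
      · intro h
        exact ⟨_, _, rfl, rfl, h⟩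
      · rintro ⟨K, o, rfl, rfl, h⟩
        exact h
    rw [this]
    refine MeasurableSet.iUnion fun K => MeasurableSet.iUnion fun o => (ih K).inter
      ((hx (A.measurable_next n K o)).inter ?_)
    cases o with
    | none =>
      change MeasurableSet {_p : A.Rand × (ℕ → X × Label) | K = L}
      exact MeasurableSet.const _
    | some i =>
      have hy : Measurable fun p : A.Rand × (ℕ → X × Label) => (p.2 i).2 := by fun_prop
      exact hy (MeasurableSet.of_discrete (s := {b : Label | K ++ [b] = L}))

theorem measurable_errorRate_run (P : JointDist X) (n : ℕ) :
    Measurable fun p : A.Rand × (ℕ → X × Label) => errorRate P (A.run n p.1 p.2) := by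
  intro S hS
  have hx : Measurable fun p : A.Rand × (ℕ → X × Label) => (p.1, fun i => (p.2 i).1) := by
    fun_prop
  have : (fun p : A.Rand × (ℕ → X × Label) => errorRate P (A.run n p.1 p.2)) ⁻¹' S =
      ⋃ L : List Label, {p : A.Rand × (ℕ → X × Label) |
        A.received n p.1 (fun i => (p.2 i).1) (fun i => (p.2 i).2) n = L} ∩
        (fun p => errorRate P (A.output n p.1 (fun i => (p.2 i).1) L)) ⁻¹' S := by
    ext p
    simp only [mem_iUnion, mem_inter_iff, mem_ofPred_eq, mem_preimage]
    constructor
    · intro h; exact ⟨_, rfl, h⟩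
    · rintro ⟨L, rfl, h⟩; exact h
  rw [this]
  exact MeasurableSet.iUnion fun L => (A.measurableSet_received_eq n n L).inter
    (((measurable_errorRate P (f := fun p : A.Rand × (ℕ → X) => A.output n p.1 p.2 L)
      (A.measurable_output n L)).comp hx) hS)

end ActiveAlgorithm

/-- The expected error, under the member `θ` of the hard family, given the internal randomness and
the unlabeled examples. -/
noncomputable def ActiveAlgorithm.condError (A : ActiveAlgorithm.{0, v} I) (θ : I) (n : ℕ)
    (w : A.Rand × (ℕ → I)) : ℝ :=
  ∫ y, errorRate (hardDist θ) (A.output n w.1 w.2 ((queryStep (A.next n w.1 w.2) y)^[n] []))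
    ∂labelSeqLaw fun i => hardBias θ (w.2 i)

/-- Given the internal randomness and the unlabeled examples, whose law does not depend on θ, the
labels are independent coins. The lower bound may therefore be proved for each `w` separately and
integrated. -/
theorem ActiveAlgorithm.expectedError_hardDist (A : ActiveAlgorithm.{0, v} I) (θ : I) (n : ℕ) :
    Integrable (A.condError θ n)
      (A.law.prod (Measure.infinitePi fun _ : ℕ => halfAtomMarginal)) ∧
    A.expectedError (hardDist θ) n = ∫ w, A.condError θ n w
      ∂(A.law.prod (Measure.infinitePi fun _ : ℕ => halfAtomMarginal)) := by
  let M := Measure.infinitePi fun _ : ℕ => halfAtomMarginal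
  let V := Measure.infinitePi fun _ : ℕ => (volume : Measure I)
  let Φ : (ℕ → I) × (ℕ → I) → ℕ → I × Label := fun w i => hardLabel θ (w.1 i, w.2 i)
  have hΦm : Measurable Φ := measurable_pi_lambda _ fun i =>
    (measurable_hardLabel θ).comp (by fun_prop)
  have hΦ : MeasurePreserving Φ (M.prod V)
      (Measure.infinitePi fun _ : ℕ => (hardDist θ : Measure (I × Label))) :=
    ⟨hΦm, map_prod_infinitePi halfAtomMarginal volume (measurable_hardLabel θ)⟩
  have hΨ : MeasurePreserving (fun p : (A.Rand × (ℕ → I)) × (ℕ → I) => (p.1.1, Φ (p.1.2, p.2)))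
      ((A.law.prod M).prod V)
      (A.law.prod (Measure.infinitePi fun _ : ℕ => (hardDist θ : Measure (I × Label)))) :=
    ((MeasurePreserving.id A.law).prod hΦ).comp (measurePreserving_prodAssoc A.law M V)
  let f : A.Rand × (ℕ → I × Label) → ℝ := fun p => errorRate (hardDist θ) (A.run n p.1 p.2)
  have hf : Measurable f := A.measurable_errorRate_run (hardDist θ) n
  have hint : Integrable (fun p : (A.Rand × (ℕ → I)) × (ℕ → I) => f (p.1.1, Φ (p.1.2, p.2)))
      ((A.law.prod M).prod V) :=
    Integrable.of_bound (hf.comp hΨ.measurable).aestronglyMeasurable 1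
      (Eventually.of_forall fun p => by
        rw [Real.norm_of_nonneg (errorRate_nonneg _ _)]; exact errorRate_le_one _ _)
  have hinner (w : A.Rand × (ℕ → I)) :
      ∫ u, f (w.1, Φ (w.2, u)) ∂V = A.condError θ n w := by
    have hmap : V.map (fun u i => decide (u i ≤ hardBias θ (w.2 i))) =
        labelSeqLaw fun i => hardBias θ (w.2 i) :=
      Measure.infinitePi_map_pi (μ := fun _ : ℕ => (volume : Measure I))
        (f := fun i u => decide (u ≤ hardBias θ (w.2 i)))
        fun i => measurable_decide_le measurable_id' measurable_const
    have hm : Measurable fun (u : ℕ → I) (i : ℕ) => decide (u i ≤ hardBias θ (w.2 i)) :=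
      measurable_pi_lambda _ fun i =>
        measurable_decide_le (measurable_pi_apply i) measurable_const
    rw [ActiveAlgorithm.condError, ← hmap, integral_map hm.aemeasurable
      (measurable_iterate_queryStep (A.next n w.1 w.2) (fun L =>
        errorRate (hardDist θ) (A.output n w.1 w.2 L)) n []).aestronglyMeasurable]
    refine integral_congr_ae (Eventually.of_forall fun u => ?_)
    simp only [f, ActiveAlgorithm.run, ActiveAlgorithm.received_eq_iterate]
    rfl
  constructor
  · have := hint.integral_prod_left
    simpa only [hinner] using this
  · calc A.expectedError (hardDist θ) n
        = ∫ p, f (p.1.1, Φ (p.1.2, p.2)) ∂((A.law.prod M).prod V) := by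
          rw [ActiveAlgorithm.expectedError, ← hΨ.map_eq,
            integral_map hΨ.measurable.aemeasurable hf.aestronglyMeasurable]
      _ = _ := by
          rw [integral_prod _ hint]
          simp only [hinner]
          rfl

/-- With few labels, an active algorithm is far from optimal for one of two nearby members of the
hard family. -/
theorem ActiveAlgorithm.excess_add_excess_lower_bound (A : ActiveAlgorithm.{0, v} I) {θ θ' : I}
    (hθ : (θ : ℝ) ∈ Ioo (1 / 8 : ℝ) (3 / 8)) (hθ' : (θ' : ℝ) ∈ Ioo (1 / 8 : ℝ) (3 / 8))
    (hlt : θ < θ') {n : ℕ} (hn : (1 + 10 * ((θ' : ℝ) - θ) ^ 2) ^ n ≤ 4) :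
    ((θ' : ℝ) - θ) ^ 2 / 120 ≤
      (A.expectedError (hardDist θ) n - noiseRate thresholdClass (hardDist θ)) +
      (A.expectedError (hardDist θ') n - noiseRate thresholdClass (hardDist θ')) := by
  have hP := isHard_hardDist hθ
  have hQ := isHard_hardDist hθ'
  obtain ⟨i1, e1⟩ := A.expectedError_hardDist θ n
  obtain ⟨i2, e2⟩ := A.expectedError_hardDist θ' n
  set ν := noiseRate thresholdClass (hardDist θ) with hν
  set ν' := noiseRate thresholdClass (hardDist θ') with hν'
  have hd : 0 < (θ' : ℝ) - θ := sub_pos.2 (by exact hlt)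
  have hd2 : 0 < ((θ' : ℝ) - θ) ^ 2 := by positivity
  suffices h : ∀ w, ((θ' : ℝ) - θ) ^ 2 / 120 + (ν + ν') ≤
      A.condError θ n w + A.condError θ' n w by
    have h1 : ∫ _w, (((θ' : ℝ) - θ) ^ 2 / 120 + (ν + ν'))
        ∂(A.law.prod (Measure.infinitePi fun _ : ℕ => halfAtomMarginal)) ≤ _ :=
      integral_mono (integrable_const _) (i1.add i2) h
    simp only [Pi.add_apply] at h1
    rw [integral_add i1 i2, ← e1, ← e2, integral_const, probReal_univ, one_smul] at h1
    linarith
  intro w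
  set c := ((θ' : ℝ) - θ) ^ 2 / 30 with hc
  have hc0 : 0 < c := by positivity
  have hν0 := hP.noiseRate_nonneg
  have hν0' := hQ.noiseRate_nonneg
  let F : List Label → ℝ := fun L => (errorRate (hardDist θ) (A.output n w.1 w.2 L) - ν) / c
  let G : List Label → ℝ := fun L => (errorRate (hardDist θ') (A.output n w.1 w.2 L) - ν') / c
  -- Dividing the excess errors by `c` makes their sum at least 1. With (1 + κ)^n ≤ 4 and t = 1, the
  -- choice s = 1/4 yields 2s - 4s² = 1/4, whence d²/120 from c = d²/30.
  have key := two_point_bound (A.next n w.1 w.2) (F := F) (G := G) (B := 1 / c)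
    (κ := 10 * ((θ' : ℝ) - θ) ^ 2) (s := 1 / 4)
    (fun L => div_nonneg (sub_nonneg.2 (hP.noiseRate_eq.trans_le (hP.le_errorRate _))) hc0.le)
    (fun L => div_nonneg (sub_nonneg.2 (hQ.noiseRate_eq.trans_le (hQ.le_errorRate _))) hc0.le)
    (fun L => div_le_div_of_nonneg_right (by
      linarith [errorRate_le_one (hardDist θ) (A.output n w.1 w.2 L)]) hc0.le)
    (fun L => div_le_div_of_nonneg_right (by
      linarith [errorRate_le_one (hardDist θ') (A.output n w.1 w.2 L)]) hc0.le)
    (fun L => by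
      simp only [F, G]
      rw [← add_div, le_div_iff₀ hc0, one_mul]
      exact hP.sq_le_excess_add_excess hQ hlt _)
    (by positivity) (by norm_num) n []
    (fun i => hardBias θ (w.2 i)) (fun i => hardBias θ' (w.2 i))
    (fun i => biasClose_hardBias hθ (w.2 i)) 1 zero_le_one
  have hI (τ : I) (a : ℝ) : ∫ y, (errorRate (hardDist τ)
      (A.output n w.1 w.2 ((queryStep (A.next n w.1 w.2) y)^[n] [])) - a) / c
      ∂labelSeqLaw (fun i => hardBias τ (w.2 i)) = (A.condError τ n w - a) / c := by
    rw [integral_div, integral_sub _ (integrable_const _), integral_const, probReal_univ, one_smul]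
    · rfl
    · exact Integrable.of_bound (measurable_iterate_queryStep (A.next n w.1 w.2) (fun L =>
        errorRate (hardDist τ) (A.output n w.1 w.2 L)) n []).aestronglyMeasurable 1
        (Eventually.of_forall fun p => by
          rw [Real.norm_of_nonneg (errorRate_nonneg _ _)]; exact errorRate_le_one _ _)
  simp only [F, G] at key
  rw [hI, hI, one_mul, ← add_div, le_div_iff₀ hc0] at key
  nlinarith

/-! ## The passive algorithm -/

theorem integral_sq_sum_pi_le {α : Type*} [MeasurableSpace α] {μ : Measure α}
    [IsProbabilityMeasure μ] {f : α → ℝ} (hf : Measurable f) (hb : ∀ a, |f a| ≤ 1)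
    (h0 : ∫ a, f a ∂μ = 0) (n : ℕ) :
    Integrable (fun S : Fin n → α => (∑ i, f (S i)) ^ 2) (Measure.pi fun _ => μ) ∧
      ∫ S : Fin n → α, (∑ i, f (S i)) ^ 2 ∂(Measure.pi fun _ => μ) ≤ n := by
  have hL : MemLp f 2 μ := MemLp.of_bound hf.aestronglyMeasurable 1 (Eventually.of_forall hb)
  have hLi (i : Fin n) : MemLp (fun S : Fin n → α => f (S i)) 2 (Measure.pi fun _ => μ) :=
    hL.comp_measurePreserving (measurePreserving_eval (fun _ : Fin n => μ) i)
  have hmean : ∫ S : Fin n → α, (∑ i, fun S : Fin n → α => f (S i)) S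
      ∂(Measure.pi fun _ => μ) = 0 := by
    simp only [Finset.sum_apply]
    rw [integral_finsetSum _ fun i _ => (hLi i).integrable (by norm_num)]
    refine Finset.sum_eq_zero fun i _ => ?_
    have h := integral_map (μ := Measure.pi fun _ : Fin n => μ)
      (measurable_pi_apply i).aemeasurable (f := f) hf.aestronglyMeasurable
    rw [(measurePreserving_eval (fun _ : Fin n => μ) i).map_eq, h0] at h
    exact h.symm
  have hsum : MemLp (∑ i, fun S : Fin n → α => f (S i)) 2 (Measure.pi fun _ => μ) :=
    memLp_finsetSum' _ fun i _ => hLi i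
  have hvar := ProbabilityTheory.variance_sum_pi (μ := fun _ : Fin n => μ) (X := fun _ => f)
    fun _ => hL
  rw [ProbabilityTheory.variance_of_integral_eq_zero hsum.aestronglyMeasurable.aemeasurable
    hmean] at hvar
  have hI := hsum.integrable_sq
  simp only [Finset.sum_apply] at hvar hI
  refine ⟨hI, hvar.trans_le ?_⟩
  have h1 : ProbabilityTheory.variance f μ ≤ 1 := by
    rw [ProbabilityTheory.variance_of_integral_eq_zero hf.aemeasurable h0]
    have : ∫ _a, (1 : ℝ) ∂μ = 1 := by simp
    rw [← this]
    exact integral_mono_of_nonneg (Eventually.of_forall fun a => sq_nonneg _)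
      (integrable_const _) (Eventually.of_forall fun a => by
        simpa using (sq_le_one_iff_abs_le_one (f a)).2 (hb a))
  calc ∑ _i : Fin n, ProbabilityTheory.variance f μ ≤ ∑ _i : Fin n, (1 : ℝ) :=
        Finset.sum_le_sum fun _ _ => h1
    _ = n := by simp

/-- The examples at `0`. -/
def atZero : Set (I × Label) := {0} ×ˢ univ

/-- The positive examples at `0`. -/
def atZeroPos : Set (I × Label) := {0} ×ˢ {true}

theorem measurableSet_atZero : MeasurableSet atZero :=
  (measurableSet_singleton _).prod MeasurableSet.univ

theorem measurableSet_atZeroPos : MeasurableSet atZeroPos :=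
  (measurableSet_singleton _).prod (measurableSet_singleton _)

theorem countZero_eq_sum {n : ℕ} (S : Fin n → I × Label) :
    (countZero S : ℝ) = ∑ i, atZero.indicator (fun _ => (1 : ℝ)) (S i) := by
  rw [countZero, Finset.card_filter]
  push_cast
  exact Finset.sum_congr rfl fun i _ => by simp [atZero, indicator]

theorem countZeroPos_eq_sum {n : ℕ} (S : Fin n → I × Label) :
    (countZeroPos S : ℝ) = ∑ i, atZeroPos.indicator (fun _ => (1 : ℝ)) (S i) := by
  rw [countZeroPos, Finset.card_filter]
  push_cast
  exact Finset.sum_congr rfl fun i _ => by simp [atZeroPos, indicator, Prod.ext_iff]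

theorem etaHat_mem {n : ℕ} (S : Fin n → I × Label) : etaHat S ∈ Icc (1 / 8 : ℝ) (3 / 8) := by
  rw [etaHat]
  split_ifs
  · norm_num
  · exact ⟨le_inf le_sup_right (by norm_num), inf_le_right⟩

theorem sq_clip_sub_le {a b x y : ℝ} (hy : y ∈ Icc a b) :
    ((x ⊔ a) ⊓ b - y) ^ 2 ≤ (x - y) ^ 2 := by
  have h : y = (y ⊔ a) ⊓ b := by rw [sup_eq_left.2 hy.1, inf_eq_left.2 hy.2]
  rw [sq_le_sq]
  conv_lhs => rw [h]
  exact (abs_inf_sub_inf_le_abs _ _ _).trans (abs_sup_sub_sup_le_abs _ _ _)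

/-- The estimation error of `etaHat` is controlled by the deviations of the two counts. -/
theorem sq_etaHat_sub_le {n : ℕ} (hn : 0 < n) (S : Fin n → I × Label) {θ : ℝ}
    (hθ : θ ∈ Icc (1 / 8 : ℝ) (3 / 8)) :
    (etaHat S - θ) ^ 2 ≤ 16 / (n : ℝ) ^ 2 *
      ((countZeroPos S - θ * countZero S) ^ 2 + (countZero S - (n : ℝ) / 2) ^ 2) := by
  have hn' : (0 : ℝ) < n := Nat.cast_pos.2 hn
  have he := etaHat_mem S
  rw [div_mul_eq_mul_div, le_div_iff₀ (by positivity)]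
  have hK : (0 : ℝ) ≤ countZero S := Nat.cast_nonneg _
  -- The split removes the random denominator. If at least n/4 examples lie at 0, division by the
  -- count costs at most the factor 16/n². Otherwise the count deviates from n/2 by more than n/4,
  -- and its deviation term alone exceeds the trivial bound 1.
  rcases le_or_gt (n : ℝ) (4 * countZero S) with h | h
  · have hpos : (0 : ℝ) < countZero S := by linarith
    have h0 : countZero S ≠ 0 := by exact_mod_cast hpos.ne'
    have h1 : (etaHat S - θ) ^ 2 ≤ ((countZeroPos S : ℝ) / countZero S - θ) ^ 2 := by
      rw [etaHat, if_neg h0]; exact sq_clip_sub_le hθ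
    have h2 : ((countZeroPos S : ℝ) / countZero S - θ) ^ 2 * (countZero S : ℝ) ^ 2 =
        (countZeroPos S - θ * countZero S) ^ 2 := by
      field_simp
    have h3 : (n : ℝ) ^ 2 ≤ 16 * (countZero S : ℝ) ^ 2 := by nlinarith
    nlinarith [mul_le_mul_of_nonneg_left h3 (sq_nonneg (etaHat S - θ)),
      mul_le_mul_of_nonneg_right h1 (sq_nonneg (countZero S : ℝ)),
      sq_nonneg ((countZero S : ℝ) - n / 2)]
  · have h1 : (etaHat S - θ) ^ 2 ≤ 1 := by
      rw [sq_le_one_iff_abs_le_one, abs_le]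
      constructor <;> linarith [he.1, he.2, hθ.1, hθ.2]
    have h2 : (n : ℝ) ^ 2 ≤ 16 * (countZero S - (n : ℝ) / 2) ^ 2 := by nlinarith
    nlinarith [sq_nonneg ((countZeroPos S : ℝ) - θ * countZero S), sq_nonneg (n : ℝ)]

theorem halfAtomMarginal_singleton_zero : halfAtomMarginal.real {0} = 1 / 2 := by
  simp [measureReal_def, halfAtomMarginal]

namespace IsHard

variable {P : JointDist I} {θ : ℝ}

theorem measureReal_atZero (hP : IsHard P θ) :
    (P : Measure (I × Label)).real atZero = 1 / 2 := by
  rw [← halfAtomMarginal_singleton_zero, ← hP.fst_eq, measureReal_def, measureReal_def,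
    Measure.fst_apply (measurableSet_singleton _)]
  congr 2; ext; simp [atZero]

theorem measureReal_atZeroPos (hP : IsHard P θ) :
    (P : Measure (I × Label)).real atZeroPos = θ / 2 := by
  rw [atZeroPos, hP.cond.2.2 _ (measurableSet_singleton _), hP.fst_eq, integral_singleton,
    halfAtomMarginal_singleton_zero]
  simp [hardEta]; ring

/-- Both count deviations are sums of `n` independent centered variables bounded by 1, so each has
second moment at most `n`. -/
theorem expectedError_checkAlgorithm_le (hP : IsHard P θ) {n : ℕ} (hn : 0 < n) :
    checkAlgorithm.{u}.expectedError P n ≤ noiseRate thresholdClass P + 112 / n := by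
  have hn' : (0 : ℝ) < n := Nat.cast_pos.2 hn
  have hθ := hP.mem
  let Z : I × Label → ℝ := fun q =>
    atZeroPos.indicator (fun _ => (1 : ℝ)) q - θ * atZero.indicator (fun _ => (1 : ℝ)) q
  let W : I × Label → ℝ := fun q => atZero.indicator (fun _ => (1 : ℝ)) q - 1 / 2
  have m1 : Measurable (atZeroPos.indicator fun _ => (1 : ℝ)) :=
    measurable_const.indicator measurableSet_atZeroPos
  have m2 : Measurable (atZero.indicator fun _ => (1 : ℝ)) :=
    measurable_const.indicator measurableSet_atZero
  have i1 : Integrable (atZeroPos.indicator fun _ => (1 : ℝ)) (P : Measure (I × Label)) :=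
    (integrable_const _).indicator measurableSet_atZeroPos
  have i2 : Integrable (atZero.indicator fun _ => (1 : ℝ)) (P : Measure (I × Label)) :=
    (integrable_const _).indicator measurableSet_atZero
  obtain ⟨iZ, eZ⟩ := integral_sq_sum_pi_le (μ := (P : Measure (I × Label))) (f := Z)
    (m1.sub (m2.const_mul θ))
    (fun q => by
      have hsub : q ∈ atZeroPos → q ∈ atZero := fun h => ⟨h.1, trivial⟩
      simp only [Z, indicator]
      rw [abs_le]
      split_ifs <;> first | tauto | (constructor <;> linarith [hθ.1, hθ.2]))
    (by
      simp only [Z]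
      rw [integral_sub i1 (i2.const_mul θ), integral_const_mul,
        integral_indicator_const _ measurableSet_atZeroPos,
        integral_indicator_const _ measurableSet_atZero, hP.measureReal_atZero,
        hP.measureReal_atZeroPos, smul_eq_mul, smul_eq_mul]
      ring) n
  obtain ⟨iW, eW⟩ := integral_sq_sum_pi_le (μ := (P : Measure (I × Label))) (f := W)
    (m2.sub measurable_const)
    (fun q => by
      simp only [W, indicator]
      rw [abs_le]
      split_ifs <;> constructor <;> norm_num)
    (by
      simp only [W]
      rw [integral_sub i2 (integrable_const _),
        integral_indicator_const _ measurableSet_atZero, hP.measureReal_atZero]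
      simp) n
  let g : (Fin n → I × Label) → ℝ := fun S => noiseRate thresholdClass P +
    56 / (n : ℝ) ^ 2 * ((∑ i, Z (S i)) ^ 2 + (∑ i, W (S i)) ^ 2)
  have iZW : Integrable (fun S : Fin n → I × Label => (∑ i, Z (S i)) ^ 2 + (∑ i, W (S i)) ^ 2)
      (Measure.pi fun _ => (P : Measure (I × Label))) := iZ.add iW
  have hg : Integrable g (Measure.pi fun _ => (P : Measure (I × Label))) :=
    (integrable_const _).add (iZW.const_mul _)
  have hpt (S : Fin n → I × Label) : errorRate P (thresholdClassifier (zHat S)) ≤ g S := by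
    have hmem := crossing_mem (etaHat_mem S)
    have h1 := hP.errorRate_thresholdClassifier_le hmem
    have h2 := sq_crossing_sub_le (etaHat_mem S) (Ioo_subset_Icc_self hθ)
    have h3 := sq_etaHat_sub_le hn S (Ioo_subset_Icc_self hθ)
    have hZ : ∑ i, Z (S i) = countZeroPos S - θ * countZero S := by
      simp only [Z]
      rw [Finset.sum_sub_distrib, ← Finset.mul_sum, countZero_eq_sum, countZeroPos_eq_sum]
    have hW : ∑ i, W (S i) = countZero S - (n : ℝ) / 2 := by
      simp only [W]
      rw [Finset.sum_sub_distrib, countZero_eq_sum]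
      simp; ring
    simp only [g, hZ, hW]
    -- The factor 1/2 comes from the quadratic excess bound, 7 from the Lipschitz bound on
    -- `crossing`, and 16 from `sq_etaHat_sub_le`.
    have h4 : (56 : ℝ) / (n : ℝ) ^ 2 = 7 / 2 * (16 / (n : ℝ) ^ 2) := by ring
    rw [h4, mul_assoc]
    change errorRate P (thresholdClassifier (crossing (etaHat S))) ≤ _
    linarith
  calc checkAlgorithm.{u}.expectedError P n
      ≤ ∫ p : PUnit.{u + 1} × (Fin n → I × Label), g p.2
        ∂((Measure.dirac PUnit.unit).prod (Measure.pi fun _ => (P : Measure (I × Label)))) :=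
        integral_mono_of_nonneg (Eventually.of_forall fun p => errorRate_nonneg _ _)
          (hg.comp_snd (Measure.dirac PUnit.unit)) (Eventually.of_forall fun p => hpt p.2)
    _ = ∫ S, g S ∂(Measure.pi fun _ => (P : Measure (I × Label))) := by
        rw [integral_fun_snd]; simp
    _ ≤ noiseRate thresholdClass P + 56 / (n : ℝ) ^ 2 * (n + n) := by
        simp only [g]
        rw [integral_add (integrable_const _) (iZW.const_mul _), integral_const_mul,
          integral_add iZ iW, integral_const, probReal_univ, one_smul]
        gcongr
    _ = _ := by field_simp; ring

end IsHard

/-! ## The label complexities -/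

open scoped Classical in
/-- A label complexity achieved by `checkAlgorithm`, infinite outside the hard family. -/
noncomputable def checkComplexity : LabelComplexity I := fun ε P =>
  if P ∈ hardFamily ∧ noiseRate thresholdClass P < ε then
    (⌈112 / (ε - noiseRate thresholdClass P)⌉₊ : ℕ∞) else ⊤

theorem checkComplexity_add {P : JointDist I} (hP : P ∈ hardFamily) {ε : ℝ} (hε : 0 < ε) :
    checkComplexity (noiseRate thresholdClass P + ε) P = (⌈112 / ε⌉₊ : ℕ∞) := by
  rw [checkComplexity, if_pos ⟨hP, by linarith⟩, add_sub_cancel_left]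

theorem achieves_checkComplexity : checkAlgorithm.{u}.Achieves checkComplexity := by
  constructor
  · intro ε P
    rw [checkComplexity]
    split_ifs with h
    · have : 0 < 112 / (ε - noiseRate thresholdClass P) := div_pos (by norm_num) (by linarith [h.2])
      exact_mod_cast Nat.ceil_pos.2 this
    · exact ENat.top_pos
  · intro P ε _ n hn
    rw [checkComplexity] at hn
    split_ifs at hn with h
    · obtain ⟨θ, hθ⟩ := mem_hardFamily_iff.1 h.1
      have hd : 0 < ε - noiseRate thresholdClass P := by linarith [h.2]
      have hn' : 112 / (ε - noiseRate thresholdClass P) ≤ n := Nat.ceil_le.1 (by exact_mod_cast hn)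
      have hn0 : (0 : ℝ) < n := lt_of_lt_of_le (by positivity) hn'
      have h1 := hθ.expectedError_checkAlgorithm_le.{u} (Nat.cast_pos.1 hn0)
      have h2 : 112 / (n : ℝ) ≤ ε - noiseRate thresholdClass P := by
        rw [div_le_iff₀ hd] at hn'
        rw [div_le_iff₀ hn0]
        linarith
      linarith
    · simp at hn

theorem ofReal_le_checkComplexity {P : JointDist I} (hP : P ∈ hardFamily) {ε : ℝ} (hε : 0 < ε) :
    ENNReal.ofReal (1 / ε) ≤ (checkComplexity (noiseRate thresholdClass P + ε) P : ℝ≥0∞) := by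
  rw [checkComplexity_add hP hε, ENat.toENNReal_coe, ← ENNReal.ofReal_natCast]
  refine ENNReal.ofReal_le_ofReal (le_trans ?_ (Nat.le_ceil _))
  gcongr; norm_num

theorem checkComplexity_le_ofReal {P : JointDist I} (hP : P ∈ hardFamily) {ε : ℝ} (hε : 0 < ε)
    (hε1 : ε ≤ 1) : (checkComplexity (noiseRate thresholdClass P + ε) P : ℝ≥0∞) ≤
      ENNReal.ofReal 113 * ENNReal.ofReal (1 / ε) := by
  rw [checkComplexity_add hP hε, ENat.toENNReal_coe, ← ENNReal.ofReal_natCast,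
    ← ENNReal.ofReal_mul (by norm_num)]
  refine ENNReal.ofReal_le_ofReal ((Nat.ceil_lt_add_one (by positivity)).le.trans ?_)
  have : 1 ≤ 1 / ε := by rw [le_div_iff₀ hε]; linarith
  calc 112 / ε + 1 = 112 * (1 / ε) + 1 := by ring
    _ ≤ _ := by linarith

theorem eventually_nhdsGT_zero_lt_one : ∀ᶠ ε : ℝ in 𝓝[>] 0, 0 < ε ∧ ε < 1 :=
  Ioo_mem_nhdsGT zero_lt_one

theorem bigTheta_checkComplexity {P : JointDist I} (hP : P ∈ hardFamily) :
    BigTheta (fun ε => (checkComplexity (noiseRate thresholdClass P + ε) P : ℝ≥0∞))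
      (fun ε => ENNReal.ofReal (1 / ε)) := by
  constructor
  · refine lt_of_le_of_lt (limsup_le_of_le (a := ENNReal.ofReal 113) (by isBoundedDefault) ?_)
      ENNReal.ofReal_lt_top
    filter_upwards [eventually_nhdsGT_zero_lt_one] with ε hε
    exact ENNReal.div_le_of_le_mul (checkComplexity_le_ofReal hP hε.1 hε.2.le)
  · refine lt_of_le_of_lt (limsup_le_of_le (a := 1) (by isBoundedDefault) ?_) ENNReal.one_lt_top
    filter_upwards [eventually_nhdsGT_zero_lt_one] with ε hε
    refine ENNReal.div_le_of_le_mul ?_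
    rw [one_mul]
    exact ofReal_le_checkComplexity hP hε.1

theorem mem_nontrivialDists {P : JointDist I} (hP : P ∈ hardFamily) :
    P ∈ NontrivialDists checkComplexity thresholdClass := by
  constructor
  · intro ε hε
    rw [checkComplexity_add hP hε]
    exact ENat.natCast_lt_top _
  · rintro g ⟨k, hk, hg⟩
    obtain ⟨M, hM1, hM2⟩ := exists_between hg
    have hlim : Tendsto (fun ε : ℝ => Real.log (1 / ε) ^ k * ε) (𝓝[>] 0) (𝓝 0) := by
      have h := (isLittleO_log_rpow_rpow_atTop k (zero_lt_one (α := ℝ))).tendsto_div_nhds_zero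
      refine (h.comp tendsto_inv_nhdsGT_zero).congr fun ε => ?_
      simp
    have hlim' : Tendsto (fun ε : ℝ => M * ENNReal.ofReal (Real.log (1 / ε) ^ k * ε))
        (𝓝[>] 0) (𝓝 0) := by
      have := ENNReal.Tendsto.const_mul (a := M) (ENNReal.tendsto_ofReal hlim) (Or.inr hM2.ne)
      simpa using this
    refine tendsto_of_tendsto_of_tendsto_of_le_of_le' tendsto_const_nhds hlim'
      (Eventually.of_forall fun _ => zero_le) ?_
    filter_upwards [eventually_nhdsGT_zero_lt_one, eventually_lt_of_limsup_lt hM1] with ε hε hε2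
    have hlog : 0 < Real.log (1 / ε) := Real.log_pos (by rw [lt_div_iff₀ hε.1]; linarith [hε.2])
    have hpow : 0 < Real.log (1 / ε) ^ k := Real.rpow_pos_of_pos hlog k
    rw [ENNReal.div_lt_iff (Or.inl (ENNReal.ofReal_pos.2 hpow).ne')
      (Or.inl ENNReal.ofReal_ne_top)] at hε2
    refine ENNReal.div_le_of_le_mul (hε2.le.trans ?_)
    rw [mul_assoc]
    refine mul_le_mul_right ?_ M
    calc ENNReal.ofReal (Real.log (1 / ε) ^ k)
        = ENNReal.ofReal (Real.log (1 / ε) ^ k * ε) * ENNReal.ofReal (1 / ε) := by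
          rw [← ENNReal.ofReal_mul (mul_nonneg hpow.le hε.1.le)]
          congr 1
          have := hε.1.ne'
          field_simp
      _ ≤ _ := mul_le_mul_right (ofReal_le_checkComplexity hP hε.1) _

/-! ## No active algorithm beats the rate `1/ε` on the hard family -/

theorem ActiveAlgorithm.expectedError_le_of_littleO (A : ActiveAlgorithm.{0, v} I)
    {Λ : LabelComplexity I} (hA : A.Achieves Λ) {P : JointDist I} {θ : ℝ} (hP : IsHard P θ)
    (hΛ : LittleO (fun ε => (Λ (noiseRate thresholdClass P + ε) P : ℝ≥0∞))
      (fun ε => ENNReal.ofReal (1 / ε))) {δ : ℝ} (hδ : 0 < δ) :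
    ∀ᶠ n : ℕ in atTop, A.expectedError P n ≤ noiseRate thresholdClass P + δ / n := by
  -- At ε = δ/n the hypothesis makes the label complexity smaller than δ/ε = n, so budget `n`
  -- suffices. Requiring ε < 1/2 keeps ν + ε below 1, where `Achieves` has content.
  have hev : ∀ᶠ ε : ℝ in 𝓝[>] 0, ∀ n : ℕ, n * ε = δ →
      A.expectedError P n ≤ noiseRate thresholdClass P + ε := by
    have h1 := hΛ.eventually (gt_mem_nhds (ENNReal.ofReal_pos.2 hδ))
    filter_upwards [h1, Ioo_mem_nhdsGT (show (0 : ℝ) < 1 / 2 by norm_num)] with ε hε hε1 n hn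
    have hε0 : 0 < 1 / ε := one_div_pos.2 hε1.1
    refine hA.2 P _ ⟨by linarith [hP.noiseRate_nonneg, hε1.1],
      by linarith [hP.noiseRate_le_half, hε1.2]⟩ n ?_
    rw [ENNReal.div_lt_iff (Or.inl (ENNReal.ofReal_pos.2 hε0).ne')
      (Or.inl ENNReal.ofReal_ne_top), ← ENNReal.ofReal_mul hδ.le, mul_one_div, ← hn,
      mul_div_cancel_right₀ _ hε1.1.ne', ENNReal.ofReal_natCast, ← ENat.toENNReal_coe] at hε
    exact ENat.toENNReal_le.1 hε.le
  have ht : Tendsto (fun n : ℕ => δ / (n : ℝ)) atTop (𝓝[>] 0) := by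
    refine tendsto_nhdsWithin_iff.2 ⟨tendsto_const_div_atTop_nhds_zero_nat δ, ?_⟩
    filter_upwards [eventually_gt_atTop 0] with n hn
    exact div_pos hδ (Nat.cast_pos.2 hn)
  filter_upwards [ht.eventually hev, eventually_gt_atTop 0] with n hn hn0
  exact hn n (by field_simp)

/-- Pigeonhole over the finitely many cells of length `ρ`. -/
theorem exists_close_of_infinite {E : Set I} (hE : E.Infinite) {ρ : ℝ} (hρ : 0 < ρ) :
    ∃ x ∈ E, ∃ y ∈ E, x < y ∧ (y : ℝ) - x < ρ := by
  have hmaps : MapsTo (fun x : I => ⌊(x : ℝ) / ρ⌋₊) E (Iic ⌊1 / ρ⌋₊) := fun x _ =>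
    Nat.floor_le_floor (div_le_div_of_nonneg_right x.2.2 hρ.le)
  obtain ⟨x, hx, y, hy, hne, he⟩ := hE.exists_ne_map_eq_of_mapsTo hmaps (finite_Iic _)
  have hlt {a b : I} (h : ⌊(a : ℝ) / ρ⌋₊ = ⌊(b : ℝ) / ρ⌋₊) : (b : ℝ) - a < ρ := by
    have h1 := Nat.floor_le (div_nonneg a.2.1 hρ.le)
    have h2 := Nat.lt_floor_add_one ((b : ℝ) / ρ)
    rw [← h] at h2
    have h3 : (b : ℝ) / ρ < a / ρ + 1 := by linarith
    rw [div_add_one hρ.ne', div_lt_div_iff_of_pos_right hρ] at h3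
    linarith
  rcases lt_or_gt_of_ne hne with h | h
  · exact ⟨x, hx, y, hy, h, hlt he⟩
  · exact ⟨y, hy, x, hx, h, hlt he.symm⟩

theorem ActiveAlgorithm.exists_not_littleO (A : ActiveAlgorithm.{0, v} I)
    {Λ : LabelComplexity I} (hA : A.Achieves Λ) : ∃ P ∈ hardFamily,
      ¬ LittleO (fun ε => (Λ (noiseRate thresholdClass P + ε) P : ℝ≥0∞))
        (fun ε => ENNReal.ofReal (1 / ε)) := by
  by_contra! hcon
  let D : Set I := {θ | (θ : ℝ) ∈ Ioo (1 / 8 : ℝ) (3 / 8)}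
  let E : ℕ → Set I := fun N => {θ | θ ∈ D ∧ ∀ n ≥ N, A.expectedError (hardDist θ) n ≤
    noiseRate thresholdClass (hardDist θ) + 1 / 5000 / n}
  have hcover : D ⊆ ⋃ N, E N := fun θ hθ => by
    have hP := isHard_hardDist hθ
    obtain ⟨N, hN⟩ := eventually_atTop.1 (A.expectedError_le_of_littleO hA hP
      (hcon _ (mem_hardFamily_iff.2 ⟨_, hP⟩)) (δ := 1 / 5000) (by norm_num))
    exact mem_iUnion.2 ⟨N, hθ, hN⟩
  have hD : volume D ≠ 0 := by
    have : D = Ioo ⟨1 / 8, by norm_num, by norm_num⟩ ⟨3 / 8, by norm_num, by norm_num⟩ := by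
      ext x; rfl
    rw [this, unitInterval.volume_Ioo]
    simp; norm_num
  -- If every `E N` were finite, `D` would be countable, hence Lebesgue null.
  obtain ⟨N, hN⟩ : ∃ N, (E N).Infinite := by
    by_contra! hfin
    exact hD (((countable_iUnion fun N => (hfin N).countable).mono hcover).measure_zero volume)
  obtain ⟨θ, hθ, θ', hθ', hlt, hclose⟩ := exists_close_of_infinite hN
    (ρ := 1 / (10 * (N + 1))) (by positivity)
  have hd : 0 < (θ' : ℝ) - θ := sub_pos.2 (by exact hlt)
  set d := (θ' : ℝ) - θ
  have hN1 : (1 : ℝ) ≤ (N : ℝ) + 1 := by linarith [Nat.cast_nonneg (α := ℝ) N]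
  have hr : (N : ℝ) + 1 ≤ 1 / (10 * d ^ 2) := by
    rw [lt_div_iff₀ (by positivity)] at hclose
    rw [le_div_iff₀ (by positivity)]
    have h1 : d * (N + 1) ≤ 1 / 10 := by linarith
    have h2 : d ≤ 1 / 10 := by nlinarith
    nlinarith [mul_le_mul h1 h2 hd.le (by norm_num)]
  -- Essentially the largest budget that cannot separate the two parameters: (1 + 10d²)^n ≤ e ≤ 4.
  -- The choice of `ρ` ensures that it exceeds `N`.
  set n := ⌊1 / (10 * d ^ 2)⌋₊ with hn
  have hn1 : N + 1 ≤ n := Nat.le_floor (by exact_mod_cast hr)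
  have hnle : (n : ℝ) ≤ 1 / (10 * d ^ 2) := Nat.floor_le (by positivity)
  have hngt : 1 / (10 * d ^ 2) < (n : ℝ) + 1 := Nat.lt_floor_add_one _
  have hn0 : (1 : ℝ) ≤ n := by exact_mod_cast (Nat.le_add_left 1 N).trans hn1
  have hpow : (1 + 10 * d ^ 2) ^ n ≤ 4 := by
    rw [le_div_iff₀ (by positivity)] at hnle
    calc (1 + 10 * d ^ 2) ^ n ≤ Real.exp (10 * d ^ 2) ^ n := by
          gcongr
          rw [add_comm]; exact Real.add_one_le_exp _
      _ = Real.exp (n * (10 * d ^ 2)) := (Real.exp_nat_mul _ _).symm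
      _ ≤ Real.exp 1 := Real.exp_le_exp.2 hnle
      _ ≤ 4 := by linarith [Real.exp_one_lt_d9]
  have hlow := A.excess_add_excess_lower_bound hθ.1 hθ'.1 hlt hpow
  have h1 := hθ.2 n (by omega)
  have h2 := hθ'.2 n (by omega)
  -- From 1/(10d²) < n + 1 ≤ 2n one gets 1/n < 20d². The two excess errors then sum to at most
  -- d²/125, just below the d²/120 of `hlow`; this fixes the constant 1/5000.
  have h3 : 1 / 5000 / (n : ℝ) ≤ d ^ 2 / 250 := by
    rw [div_lt_iff₀ (by positivity)] at hngt
    rw [div_le_iff₀ (by positivity)]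
    nlinarith [sq_nonneg d]
  change d ^ 2 / 120 ≤ _ at hlow
  have : 0 < d ^ 2 := by positivity
  linarith

/-! ### From activizers to the rate 1/ε. -/

theorem littleO_of_littleO_checkComplexity {P : JointDist I} (hP : P ∈ hardFamily)
    {a : ℝ → ℝ≥0∞} {c : ℝ} (hc : 1 ≤ c)
    (h : LittleO (fun ε => a (c * ε))
      (fun ε => (checkComplexity (noiseRate thresholdClass P + ε) P : ℝ≥0∞))) :
    LittleO a (fun ε => ENNReal.ofReal (1 / ε)) := by
  have hc0 : 0 < c := by linarith
  have ht : Tendsto (fun ε : ℝ => ε / c) (𝓝[>] 0) (𝓝[>] 0) := by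
    refine tendsto_nhdsWithin_iff.2 ⟨?_, ?_⟩
    · have : Tendsto (fun ε : ℝ => ε / c) (𝓝 0) (𝓝 (0 / c)) := tendsto_id.div_const c
      rw [zero_div] at this
      exact this.mono_left nhdsWithin_le_nhds
    · filter_upwards [self_mem_nhdsWithin] with ε hε
      exact div_pos hε hc0
  -- Substituting ε/c for ε removes `c` on the left and multiplies the comparison function, at most
  -- 113/ε for ε ≤ 1, by `c`.
  have hlim := ENNReal.Tendsto.const_mul (a := ENNReal.ofReal (113 * c)) (h.comp ht)
    (Or.inr ENNReal.ofReal_ne_top)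
  rw [mul_zero] at hlim
  refine tendsto_of_tendsto_of_tendsto_of_le_of_le' tendsto_const_nhds hlim
    (Eventually.of_forall fun _ => zero_le) ?_
  filter_upwards [eventually_nhdsGT_zero_lt_one] with ε hε
  have hε' : 0 < ε / c := div_pos hε.1 hc0
  have hle := checkComplexity_le_ofReal hP hε' ((div_le_one hc0).2 (by linarith [hε.2]))
  have hpos : checkComplexity (noiseRate thresholdClass P + ε / c) P ≠ ⊤ := by
    rw [checkComplexity_add hP hε']; exact ENat.natCast_ne_top _
  simp only [Function.comp_apply]
  rw [mul_div_cancel₀ _ hc0.ne']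
  have hb : 0 < 1 / ε := one_div_pos.2 hε.1
  have e : ENNReal.ofReal 113 * ENNReal.ofReal (1 / (ε / c)) =
      ENNReal.ofReal (113 * c) * ENNReal.ofReal (1 / ε) := by
    rw [← ENNReal.ofReal_mul (by norm_num), ← ENNReal.ofReal_mul (by positivity)]
    congr 1
    have := hε.1.ne'
    field_simp
  rw [e] at hle
  set l : ℝ≥0∞ := (checkComplexity (noiseRate thresholdClass P + ε / c) P : ℝ≥0∞)
  set M := ENNReal.ofReal (113 * c)
  have hM0 : M ≠ 0 := (ENNReal.ofReal_pos.2 (by positivity)).ne'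
  have hinv := ENNReal.inv_le_inv.2 hle
  rw [ENNReal.mul_inv (Or.inl hM0) (Or.inl ENNReal.ofReal_ne_top)] at hinv
  calc a ε / ENNReal.ofReal (1 / ε)
      = a ε * (M * (M⁻¹ * (ENNReal.ofReal (1 / ε))⁻¹)) := by
        rw [← mul_assoc M, ENNReal.mul_inv_cancel hM0 ENNReal.ofReal_ne_top, one_mul,
          div_eq_mul_inv]
    _ ≤ a ε * (M * l⁻¹) := by gcongr
    _ = M * (a ε / l) := by rw [div_eq_mul_inv]; ring

theorem mainTheorem8 :
    (¬ ∃ Aa : ActiveMetaAlgorithm.{0, u, v} I,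
      Activizes Aa checkAlgorithm.{u} thresholdClass) ∧
    ∃ Λp : LabelComplexity I, checkAlgorithm.{u}.Achieves Λp ∧
      (∀ P ∈ hardFamily,
        BigTheta (fun ε => (Λp (noiseRate thresholdClass P + ε) P : ℝ≥0∞))
          (fun ε => ENNReal.ofReal (1 / ε))) ∧
      ∀ (Aa : ActiveAlgorithm.{0, v} I) (Λa : LabelComplexity I), Aa.Achieves Λa →
        ∃ P ∈ hardFamily,
          ¬ LittleO (fun ε => (Λa (noiseRate thresholdClass P + ε) P : ℝ≥0∞))
            (fun ε => ENNReal.ofReal (1 / ε)) := by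
  refine ⟨?_, checkComplexity, achieves_checkComplexity, fun P hP => bigTheta_checkComplexity hP,
    fun Aa Λa hA => Aa.exists_not_littleO hA⟩
  rintro ⟨Aa, hAa⟩
  -- A single achieved complexity is enough for the refutation. `Λa` is fixed before P, so P may be
  -- chosen as a member of the family that is bad for it.
  obtain ⟨Λa, hA, hΛ⟩ := hAa checkComplexity achieves_checkComplexity
  obtain ⟨P, hP, hnot⟩ := (Aa checkAlgorithm).exists_not_littleO hA
  obtain ⟨c, hc, hlo⟩ := hΛ P (mem_nontrivialDists hP)
  exact hnot (littleO_of_littleO_checkComplexity hP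
    (a := fun ε => (Λa (noiseRate thresholdClass P + ε) P : ℝ≥0∞)) hc hlo)
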